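/- Let $R$ be a noetherian commutative ring and let $A$ be a Frobenius $R$-algebra, that is, an (associative, unital, not necessarily commutative) $R$-algebra that is finitely generated and projective as an $R$-module and satisfies $\operatorname{add}\omega_{A/R}=\operatorname{add}A$. Here $\omega_{A/R}=\operatorname{Hom}_R(A,R)$ is the left $A$-module with $(af)(x)=f(xa)$, and, for a left $A$-module $M$, $\operatorname{add}M$ denotes the class of all direct summands of finite direct sums of copies of $M$. For a ring $\Lambda$, let $\mathbf{K}(\operatorname{Proj}\Lambda)$ be the homotopy category of (unbounded) complexes of projective left $\Lambda$-modules. Let $\mathbf{K}(\operatorname{Proj}A,R)$ be the full subcategory of $\mathbf{K}(\operatorname{Proj}A)$ of those complexes that are $K$-projective when restricted to $R$; a complex of $R$-modules is $K$-projective if every chain map from it to an acyclic complex of $R$-modules is null-homotopic. For a prime ideal $\mathfrak{p}$ of $R$ with residue field $k(\mathfrak{p})$, put $A_{k(\mathfrak{p})}=A\otimes_R k(\mathfrak{p})$, and let $X\mapsto X_{k(\mathfrak{p})}=X\otimes_R k(\mathfrak{p})$ be the induced fibre functor $\mathbf{K}(\operatorname{Proj}A,R)\to\mathbf{K}(\operatorname{Proj}A_{k(\mathfrak{p})})$.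 Then for every object $X$ of $\mathbf{K}(\operatorname{Proj}A,R)$ one has $X=0$ in $\mathbf{K}(\operatorname{Proj}A,R)$ (that is, $X$ is a zero object) if and only if $X_{k(\mathfrak{p})}=0$ in $\mathbf{K}(\operatorname{Proj}A_{k(\mathfrak{p})})$ for all $\mathfrak{p}\in\operatorname{Spec}R$. -/

import Mathlib

open CategoryTheory Limits
open scoped TensorProduct

universe u

noncomputable section

namespace FrobDetect

section Frobenius

variable (R A : Type u) [CommRing R] [Ring A] [Algebra R A]

/-- The dualising module `ω_{A/R} = Hom_R(A, R)`. -/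
def Dualizing : Type u := A →ₗ[R] R

instance : AddCommGroup (Dualizing R A) := inferInstanceAs (AddCommGroup (A →ₗ[R] R))

/-- The left `A`-module structure on `ω_{A/R} = Hom_R(A, R)`, given by `(a • f) x = f (x * a)`. -/
instance : Module A (Dualizing R A) where
  smul a f := LinearMap.comp f (LinearMap.mulRight R a)
  one_smul f := LinearMap.ext fun x => congrArg (DFunLike.coe (F := A →ₗ[R] R) f) (mul_one x)
  mul_smul a b f :=
    LinearMap.ext fun x => congrArg (DFunLike.coe (F := A →ₗ[R] R) f) (mul_assoc x a b).symm
  smul_zero _ := rfl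
  smul_add _ _ _ := rfl
  add_smul a b f := LinearMap.ext fun x =>
    (congrArg (DFunLike.coe (F := A →ₗ[R] R) f) (mul_add x a b)).trans (LinearMap.map_add f _ _)
  zero_smul f := LinearMap.ext fun x =>
    (congrArg (DFunLike.coe (F := A →ₗ[R] R) f) (mul_zero x)).trans (LinearMap.map_zero f)

variable {A} in
/-- `add M`: the full subcategory (as a property of objects) of `Mod A` of all direct summands of
finite direct sums of copies of `M`. -/
def addClosure (M : ModuleCat.{u} A) : ObjectProperty (ModuleCat.{u} A) := fun N =>
  ∃ (n : ℕ) (i : N →ₗ[A] (Fin n → M)) (r : (Fin n → M) →ₗ[A] N), r ∘ₗ i = LinearMap.id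

/-- `A` is a Frobenius `R`-algebra: it is finitely generated and projective as an `R`-module, and
`add ω_{A/R} = add A` in the category of left `A`-modules. -/
structure IsFrobeniusAlgebra : Prop where
  finite : Module.Finite R A
  projective : Module.Projective R A
  add_dualizing_eq :
    addClosure (ModuleCat.of A (Dualizing R A)) = addClosure (ModuleCat.of A A)

end Frobenius

section HomotopyCategory

/-- The category `Proj A` of projective left `A`-modules. -/
abbrev ProjCat (A : Type u) [Ring A] :=
  ObjectProperty.FullSubcategory (fun M : ModuleCat.{u} A => Module.Projective A M)

/-- `K(Proj A)`: the homotopy category of unbounded cochain complexes of projective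
left `A`-modules. -/
abbrev KProj (A : Type u) [Ring A] := HomotopyCategory (ProjCat A) (ComplexShape.up ℤ)

variable (R A : Type u) [CommRing R] [Ring A] [Algebra R A]

/-- Restriction `Proj A ⥤ Mod R` along the structure map `R → A`. -/
abbrev projRestrict : ProjCat A ⥤ ModuleCat.{u} R :=
  ObjectProperty.ι _ ⋙ ModuleCat.restrictScalars.{u} (algebraMap R A)

instance : (projRestrict R A).Additive where
  map_add := rfl

/-- The objects of `K(Proj A)` whose restriction to `R` is K-projective. -/
def isKProjectiveOver : ObjectProperty (KProj A) := fun X =>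
  CochainComplex.IsKProjective
    (((projRestrict R A).mapHomologicalComplex (ComplexShape.up ℤ)).obj X.as)

/-- `K(Proj A, R)`: the full subcategory of `K(Proj A)` of those complexes that are K-projective
when restricted to `R`. -/
abbrev KProjOver := (isKProjectiveOver R A).FullSubcategory

end HomotopyCategory

section BaseChange

variable {R A : Type u} [CommRing R] [Ring A] [Algebra R A]

section Module

variable (R) in
/-- A left `A`-module as an `R`-module, through the structure map `R → A`. -/
@[reducible]
def moduleBase (M : ModuleCat.{u} A) : Module R M := Module.compHom M (algebraMap R A)

attribute [local instance] moduleBase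

variable (R) in
theorem isScalarTower_moduleBase (M : ModuleCat.{u} A) : IsScalarTower R A M where
  smul_assoc r a m := by
    rw [Algebra.smul_def, mul_smul]
    rfl

attribute [local instance] isScalarTower_moduleBase

variable (B : Type u) [CommRing B] [Algebra R B]

/-- The left `A ⊗[R] B`-module structure on `M ⊗[R] B`, for which
`(a ⊗ b) • (m ⊗ c) = (a • m) ⊗ (b * c)`. -/
@[reducible]
def baseChangeModule (M : ModuleCat.{u} A) : Module (A ⊗[R] B) (M ⊗[R] B) :=
  Module.compHom (M ⊗[R] B)
    ((Module.endTensorEndAlgHom (R := R) (S := R) (A := R) (M := M) (N := B)).comp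
      (Algebra.TensorProduct.map (Algebra.lsmul R R M) (Algebra.lsmul R R B))).toRingHom

attribute [local instance] baseChangeModule

theorem baseChange_smul_tmul (M : ModuleCat.{u} A) (a : A) (b : B) (m : M) (c : B) :
    (a ⊗ₜ[R] b) • (m ⊗ₜ[R] c) = (a • m) ⊗ₜ[R] (b * c) := rfl

/-- An `A`-linear map as an `R`-linear map. -/
def linearBase {M N : ModuleCat.{u} A} (f : M ⟶ N) : M →ₗ[R] N where
  toFun := f.hom
  map_add' := map_add f.hom
  map_smul' r := map_smul f.hom (algebraMap R A r)

/-- The `A ⊗[R] B`-linear map `f ⊗ B : M ⊗[R] B → N ⊗[R] B`. -/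
def baseChangeMap {M N : ModuleCat.{u} A} (f : M ⟶ N) :
    (M ⊗[R] B) →ₗ[A ⊗[R] B] (N ⊗[R] B) where
  toFun := (linearBase (R := R) f).rTensor B
  map_add' := map_add _
  map_smul' x y := by
    induction x with
    | zero => simp only [zero_smul, map_zero]
    | add x₁ x₂ h₁ h₂ => simp only [add_smul, map_add, h₁, h₂]
    | tmul a b =>
      induction y with
      | zero => simp only [smul_zero, map_zero]
      | add y₁ y₂ h₁ h₂ => simp only [smul_add, map_add, h₁, h₂]
      | tmul m c =>
        simp only [baseChange_smul_tmul, LinearMap.rTensor_tmul, RingHom.id_apply]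
        congr 1
        exact map_smul f.hom a m

theorem baseChangeMap_tmul {M N : ModuleCat.{u} A} (f : M ⟶ N) (m : M) (b : B) :
    baseChangeMap B f (m ⊗ₜ[R] b) = (f.hom m) ⊗ₜ[R] b := rfl

theorem baseChange_hom_ext {M : ModuleCat.{u} A} {N : Type u} [AddCommGroup N]
    [Module (A ⊗[R] B) N] {f g : (M ⊗[R] B) →ₗ[A ⊗[R] B] N}
    (h : ∀ m : M, f (m ⊗ₜ[R] 1) = g (m ⊗ₜ[R] 1)) : f = g := by
  refine LinearMap.ext fun y => ?_
  induction y with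
  | zero => simp only [map_zero]
  | add y₁ y₂ h₁ h₂ => simp only [map_add, h₁, h₂]
  | tmul m c =>
    have e : m ⊗ₜ[R] c = ((1 : A) ⊗ₜ[R] c) • (m ⊗ₜ[R] (1 : B)) := by
      rw [baseChange_smul_tmul, one_smul, mul_one]
    rw [e, map_smul, map_smul, h]

variable (R A) in
/-- The functor `- ⊗[R] B : Mod A ⥤ Mod (A ⊗[R] B)`. -/
def baseChange : ModuleCat.{u} A ⥤ ModuleCat.{u} (A ⊗[R] B) where
  obj M := ModuleCat.of (A ⊗[R] B) (M ⊗[R] B)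
  map f := ModuleCat.ofHom (baseChangeMap B f)
  map_id _ := ModuleCat.hom_ext (baseChange_hom_ext B fun _ => rfl)
  map_comp _ _ := ModuleCat.hom_ext (baseChange_hom_ext B fun _ => rfl)

instance : (baseChange R A B).Additive where
  map_add := ModuleCat.hom_ext (baseChange_hom_ext B fun _ => TensorProduct.add_tmul _ _ _)

/-- Base change preserves projective modules. -/
theorem baseChange_projective (M : ModuleCat.{u} A) (hM : Module.Projective A M) :
    Module.Projective (A ⊗[R] B) ((baseChange R A B).obj M) := by
  change Module.Projective (A ⊗[R] B) (M ⊗[R] B)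
  obtain ⟨s, hs⟩ := hM.out
  -- the `A`-semilinear map `A^(M) → (A ⊗ B)^(M)`
  let j : (M →₀ A) →+ (M →₀ A ⊗[R] B) :=
    Finsupp.mapRange.addMonoidHom
      (Algebra.TensorProduct.includeLeft : A →ₐ[R] A ⊗[R] B).toRingHom.toAddMonoidHom
  have hj (a : A) (v : M →₀ A) : j (a • v) = (a ⊗ₜ[R] (1 : B)) • j v := by
    ext m
    simp [j]
  have hr (r : R) (v : M →₀ A) : j (algebraMap R A r • v) = r • j v := by
    rw [hj, ← Algebra.TensorProduct.algebraMap_apply, algebraMap_smul]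
  let t : (M ⊗[R] B) →ₗ[R] (M →₀ A ⊗[R] B) :=
    TensorProduct.lift (LinearMap.mk₂ R (fun m b => ((1 : A) ⊗ₜ[R] b) • j (s m))
      (fun m n b => by rw [map_add, map_add, smul_add])
      (fun r m b => by
        have e : s (r • m) = algebraMap R A r • s m := map_smul s (algebraMap R A r) m
        rw [e, hr, smul_comm])
      (fun m b c => by rw [TensorProduct.tmul_add, add_smul])
      (fun r m b => by rw [TensorProduct.tmul_smul, smul_assoc]))
  have ht (m : M) (b : B) : t (m ⊗ₜ[R] b) = ((1 : A) ⊗ₜ[R] b) • j (s m) := rfl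
  let T : (M ⊗[R] B) →ₗ[A ⊗[R] B] (M →₀ A ⊗[R] B) :=
    { toFun := t
      map_add' := map_add t
      map_smul' := fun x y => by
        induction x with
        | zero => simp only [zero_smul, map_zero]
        | add x₁ x₂ h₁ h₂ => simp only [add_smul, map_add, h₁, h₂]
        | tmul a b =>
          induction y with
          | zero => simp only [smul_zero, map_zero]
          | add y₁ y₂ h₁ h₂ => simp only [smul_add, map_add, h₁, h₂]
          | tmul m c =>
            rw [baseChange_smul_tmul, ht, ht, map_smul, hj, smul_smul, RingHom.id_apply, smul_smul]
            simp }
  let q : (M →₀ A ⊗[R] B) →ₗ[A ⊗[R] B] (M ⊗[R] B) :=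
    Finsupp.linearCombination (A ⊗[R] B) (fun m : M => m ⊗ₜ[R] (1 : B))
  have hq (v : M →₀ A) : q (j v) = (Finsupp.linearCombination A id v : M) ⊗ₜ[R] (1 : B) := by
    induction v using Finsupp.induction_linear with
    | zero => simp only [map_zero, TensorProduct.zero_tmul]
    | add v w hv hw => simp only [map_add, TensorProduct.add_tmul, hv, hw]
    | single m a =>
      have e : j (Finsupp.single m a) = Finsupp.single m (a ⊗ₜ[R] (1 : B)) := by
        simp [j]
      rw [e, Finsupp.linearCombination_single, Finsupp.linearCombination_single,
        baseChange_smul_tmul, mul_one, id]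
  refine Module.Projective.of_split (M := M →₀ A ⊗[R] B) T q ?_
  refine baseChange_hom_ext B fun m => ?_
  have e : T (m ⊗ₜ[R] (1 : B)) = j (s m) := by
    change t _ = _
    rw [ht, ← Algebra.TensorProduct.one_def, one_smul]
  rw [LinearMap.comp_apply, e, hq, hs m]
  rfl

end Module

variable (R A) in
/-- The functor `- ⊗[R] B : Proj A ⥤ Proj (A ⊗[R] B)`. -/
def projBaseChange (B : Type u) [CommRing B] [Algebra R B] : ProjCat A ⥤ ProjCat (A ⊗[R] B) :=
  ObjectProperty.lift _ (ObjectProperty.ι _ ⋙ baseChange R A B)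
    (fun M => baseChange_projective B M.obj M.property)

instance (B : Type u) [CommRing B] [Algebra R B] : (projBaseChange R A B).Additive where
  map_add {_ _ f g} := by
    ext : 1
    exact (baseChange R A B).map_add (f := f.hom) (g := g.hom)

variable (R A) in
/-- The fibre functor `X ↦ X ⊗[R] k(p)` from `K(Proj A, R)` to `K(Proj (A ⊗[R] k(p)))`. -/
def fibre (p : PrimeSpectrum R) :
    KProjOver R A ⥤ KProj (A ⊗[R] p.asIdeal.ResidueField) :=
  ObjectProperty.ι _ ⋙
    (projBaseChange R A p.asIdeal.ResidueField).mapHomotopyCategory (ComplexShape.up ℤ)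

end BaseChange

end FrobDetect

end

/-!
Contractibility of a complex `X` of projective modules over a finite algebra `A` over a noetherian
ring `R` is detected by the fibres `X ⊗ k(𝔭)`, in two steps.

*Purity.* If all fibres are contractible, then `L ⊗_A X` is acyclic for every finitely generated
right `A`-module `L`. This is a noetherian induction on the annihilator `I` of `L` in `R`. The long
exact sequences for the kernel and the cokernel of `r : L → L`, whose annihilators are larger, show
that every `r ∉ I` acts bijectively on the homology of `L ⊗_A X`. If `I` is neither prime nor `R`,
then a product of two such elements kills `L`, so the homology vanishes. If `I` is prime, then the
homology of `L ⊗_A X` embeds in that of `(L ⊗_R k(I)) ⊗_A X`, and this complex is contractible since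
`X ⊗_R k(I)` is (`coeffAcyclic_of_primes`, `exists_smul_eq_boundary_of_contraction`).

*Pure acyclic complexes of projective modules are contractible.* Acyclicity of `L ⊗_A X` for the
submodules `L` of `A^k` provides, for each finite set of cycles `z` of `X`, a linear map `s` with
`D (s z) = z` (`exists_localContraction`). When `X` is countably generated, a telescoping sum glues
these local contractions to a contraction (`exists_contraction_of_exhaustion`). In general, a
contractible subcomplex spanned by part of a basis is a direct factor, and it can be enlarged by a
countable piece which contains a given basis element and is closed under sufficiently many local
contractions. Zorn's lemma then gives a contraction of `X`
(`IsContractionOn.exists_extension`, `exists_contraction_of_localContractions`).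

The grading plays no role, so `X` is replaced by the direct sum of its terms, with an endomorphism of
square zero. It is a retract of a free module `F = A^(B)`, hence it is encoded by two matrices: an
idempotent `p` and a differential `D` with `p D = D = D p`. The functor `L ⊗_A -` then takes `F` to
`L^(B)`, which avoids tensor products over the noncommutative ring `A` and makes exactness in `L`
evident (`coeffMap`).
-/

namespace FibreDetection

open MulOpposite

/-! ### Extension of scalars of matrices to right modules -/

section Coefficients

variable {A : Type*} [Ring A] {B : Type*}

/-- For a right `A`-module `L`, the additive map `L ⊗ φ` induced by an endomorphism `φ` of the free
left module `A^(B)`, where `L ⊗ A^(B)` is realised as `L^(B)`. -/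
noncomputable def coeffMap (L : Type*) [AddCommGroup L] [Module Aᵐᵒᵖ L]
    (φ : (B →₀ A) →ₗ[A] (B →₀ A)) : (B →₀ L) →+ (B →₀ L) :=
  Finsupp.liftAddHom fun b => AddMonoidHom.mk'
    (fun l => (φ (Finsupp.single b 1)).mapRange (fun a => op a • l) (by simp))
    (fun l m => by ext; simp)

variable {L : Type*} [AddCommGroup L] [Module Aᵐᵒᵖ L]

theorem coeffMap_single (φ : (B →₀ A) →ₗ[A] (B →₀ A)) (b : B) (l : L) :
    coeffMap L φ (Finsupp.single b l) =
      (φ (Finsupp.single b 1)).mapRange (fun a => op a • l) (by simp) :=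
  Finsupp.liftAddHom_apply_single _ _ _

theorem coeffMap_mapRange_smul (φ : (B →₀ A) →ₗ[A] (B →₀ A)) (x : B →₀ A) (l : L) :
    coeffMap L φ (x.mapRange (fun a => op a • l) (by simp)) =
      (φ x).mapRange (fun a => op a • l) (by simp) := by
  induction x using Finsupp.induction_linear with
  | zero => ext; simp
  | add x y hx hy =>
    have key (x y : B →₀ A) : (x + y).mapRange (fun a => op a • l) (by simp) =
        x.mapRange (fun a => op a • l) (by simp) + y.mapRange (fun a => op a • l) (by simp) := by
      ext; simp [add_smul]
    rw [key, map_add, hx, hy, map_add, key]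
  | single b a =>
    rw [Finsupp.mapRange_single, coeffMap_single]
    have h : φ (Finsupp.single b a) = a • φ (Finsupp.single b 1) := by
      rw [← map_smul, Finsupp.smul_single, smul_eq_mul, mul_one]
    rw [h]
    ext i
    simp [mul_smul]

theorem coeffMap_comp (φ ψ : (B →₀ A) →ₗ[A] (B →₀ A)) (x : B →₀ L) :
    coeffMap L (φ ∘ₗ ψ) x = coeffMap L φ (coeffMap L ψ x) := by
  induction x using Finsupp.induction_linear with
  | zero => simp
  | add x y hx hy => simp [hx, hy]
  | single b l => rw [coeffMap_single, coeffMap_single, coeffMap_mapRange_smul]; rfl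

theorem coeffMap_add (φ ψ : (B →₀ A) →ₗ[A] (B →₀ A)) (x : B →₀ L) :
    coeffMap L (φ + ψ) x = coeffMap L φ x + coeffMap L ψ x := by
  induction x using Finsupp.induction_linear with
  | zero => simp
  | add x y hx hy => simp [hx, hy]; abel
  | single b l => simp only [coeffMap_single]; ext; simp [add_smul]

theorem coeffMap_zero (x : B →₀ L) : coeffMap L (0 : (B →₀ A) →ₗ[A] (B →₀ A)) x = 0 := by
  have h := coeffMap_add (0 : (B →₀ A) →ₗ[A] (B →₀ A)) 0 x
  simpa using h

/-- Naturality of `coeffMap` in the right module, also along a change of rings `f : A → A'`. -/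
theorem mapRange_coeffMap {A' : Type*} [Ring A'] {L' : Type*} [AddCommGroup L'] [Module A'ᵐᵒᵖ L']
    (f : A →+* A') (g : L →+ L') (hg : ∀ a l, g (op a • l) = op (f a) • g l)
    {φ : (B →₀ A) →ₗ[A] (B →₀ A)} {φ' : (B →₀ A') →ₗ[A'] (B →₀ A')}
    (hφ : ∀ b, φ' (Finsupp.single b 1) = (φ (Finsupp.single b 1)).mapRange f f.map_zero)
    (x : B →₀ L) :
    (coeffMap L φ x).mapRange g g.map_zero = coeffMap L' φ' (x.mapRange g g.map_zero) := by
  induction x using Finsupp.induction_linear with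
  | zero => simp
  | add x y hx hy => simp only [map_add, Finsupp.mapRange_add (f := g) (map_add g), hx, hy]
  | single b l =>
    rw [coeffMap_single, Finsupp.mapRange_single, coeffMap_single, hφ]
    ext i
    simp [hg]

theorem mapRange_coeffMap_linear {L' : Type*} [AddCommGroup L'] [Module Aᵐᵒᵖ L']
    (g : L →ₗ[Aᵐᵒᵖ] L') (φ : (B →₀ A) →ₗ[A] (B →₀ A)) (x : B →₀ L) :
    (coeffMap L φ x).mapRange g g.map_zero = coeffMap L' φ (x.mapRange g g.map_zero) :=
  mapRange_coeffMap (RingHom.id A) g.toAddMonoidHom (fun _ _ => map_smul g _ _)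
    (fun _ => by ext; simp) x

theorem coeffMap_self (φ : (B →₀ A) →ₗ[A] (B →₀ A)) (x : B →₀ A) : coeffMap A φ x = φ x := by
  induction x using Finsupp.induction_linear with
  | zero => simp
  | add x y hx hy => simp [hx, hy]
  | single b a =>
    rw [coeffMap_single]
    have h : φ (Finsupp.single b a) = a • φ (Finsupp.single b 1) := by
      rw [← map_smul, Finsupp.smul_single, smul_eq_mul, mul_one]
    rw [h]
    ext i
    simp

end Coefficients

/-! ### Dévissage of the coefficient module -/

section Devissage

variable {A : Type u} [Ring A] {B : Type u}

/-- The endomorphism `D` of the free module `F = A^(B)` is a differential on the direct summand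
`p F`, extended by zero to the complement. -/
structure IsDifferentialOn (D p : (B →₀ A) →ₗ[A] (B →₀ A)) : Prop where
  D_D : D ∘ₗ D = 0
  p_D : p ∘ₗ D = D
  D_p : D ∘ₗ p = D
  p_p : p ∘ₗ p = p

/-- The differential module `L ⊗ p F` is acyclic, `L` being a right `A`-module. A cycle `z` of
`L ⊗ F` need not lie in `L ⊗ p F`, so it is its projection `p z` that is required to bound. -/
def CoeffAcyclic (D p : (B →₀ A) →ₗ[A] (B →₀ A)) (L : Type*) [AddCommGroup L]
    [Module Aᵐᵒᵖ L] : Prop :=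
  ∀ z : B →₀ L, coeffMap L D z = 0 → ∃ w, coeffMap L D w = coeffMap L p z

theorem exists_mapRange_eq {L L' : Type*} [AddCommGroup L] [AddCommGroup L'] (g : L →+ L')
    (x : B →₀ L') (h : ∀ b, ∃ l, g l = x b) : ∃ y : B →₀ L, y.mapRange g g.map_zero = x := by
  classical
  choose f hf using h
  refine ⟨Finsupp.onFinset x.support (fun b => if x b = 0 then 0 else f b) fun b hb => ?_, ?_⟩
  · simp only [Finsupp.mem_support_iff]
    intro h0
    simp [h0] at hb
  · ext b
    by_cases h0 : x b = 0 <;> simp [h0, hf]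

variable {D p : (B →₀ A) →ₗ[A] (B →₀ A)}

section Right

variable {L : Type u} [AddCommGroup L] [Module Aᵐᵒᵖ L]

theorem IsDifferentialOn.coeff_D_D (h : IsDifferentialOn D p) (x : B →₀ L) :
    coeffMap L D (coeffMap L D x) = 0 := by
  rw [← coeffMap_comp, h.D_D, coeffMap_zero]

theorem IsDifferentialOn.coeff_p_D (h : IsDifferentialOn D p) (x : B →₀ L) :
    coeffMap L p (coeffMap L D x) = coeffMap L D x := by
  rw [← coeffMap_comp, h.p_D]

theorem IsDifferentialOn.coeff_D_p (h : IsDifferentialOn D p) (x : B →₀ L) :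
    coeffMap L D (coeffMap L p x) = coeffMap L D x := by
  rw [← coeffMap_comp, h.D_p]

theorem IsDifferentialOn.coeff_p_p (h : IsDifferentialOn D p) (x : B →₀ L) :
    coeffMap L p (coeffMap L p x) = coeffMap L p x := by
  rw [← coeffMap_comp, h.p_p]

theorem CoeffAcyclic.of_submodule {N : Submodule Aᵐᵒᵖ L} (hN : CoeffAcyclic D p N) {z : B →₀ L}
    (hz : coeffMap L D z = 0) (hzN : ∀ b, z b ∈ N) :
    ∃ w, coeffMap L D w = coeffMap L p z ∧ ∀ b, w b ∈ N := by
  obtain ⟨y, rfl⟩ := exists_mapRange_eq N.subtype.toAddMonoidHom z fun b => ⟨⟨z b, hzN b⟩, rfl⟩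
  have hy : coeffMap N D y = 0 := by
    apply Finsupp.mapRange_injective N.subtype N.subtype.map_zero Subtype.val_injective
    rw [mapRange_coeffMap_linear, Finsupp.mapRange_zero]
    exact hz
  obtain ⟨w, hw⟩ := hN y hy
  refine ⟨w.mapRange N.subtype N.subtype.map_zero, ?_, fun b => (w b).2⟩
  rw [← mapRange_coeffMap_linear, hw, mapRange_coeffMap_linear]
  rfl

theorem CoeffAcyclic.of_quotient {N : Submodule Aᵐᵒᵖ L} (hN : CoeffAcyclic D p (L ⧸ N))
    {z : B →₀ L} (hz : ∀ b, coeffMap L D z b ∈ N) :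
    ∃ w, ∀ b, (coeffMap L p z - coeffMap L D w) b ∈ N := by
  obtain ⟨w', hw'⟩ := hN (z.mapRange N.mkQ N.mkQ.map_zero) (by
    rw [← mapRange_coeffMap_linear]
    ext b
    simpa using hz b)
  obtain ⟨w, rfl⟩ := Finsupp.mapRange_surjective N.mkQ N.mkQ.map_zero N.mkQ_surjective w'
  refine ⟨w, fun b => ?_⟩
  rw [← mapRange_coeffMap_linear, ← mapRange_coeffMap_linear] at hw'
  have := DFunLike.congr_fun hw' b
  simp only [Finsupp.mapRange_apply, Submodule.mkQ_apply] at this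
  exact (Submodule.Quotient.eq N).1 this.symm

end Right

variable {R : Type u} [CommRing R] [Algebra R A]

variable {L : Type u} [AddCommGroup L] [Module R L] [Module Aᵐᵒᵖ L] [IsScalarTower R Aᵐᵒᵖ L]

theorem coeffMap_smul (φ : (B →₀ A) →ₗ[A] (B →₀ A)) (r : R) (x : B →₀ L) :
    coeffMap L φ (r • x) = r • coeffMap L φ x := by
  have key (y : B →₀ L) : y.mapRange (r • LinearMap.id : L →ₗ[Aᵐᵒᵖ] L) (by simp) = r • y := by
    ext; simp
  rw [← key, ← key, mapRange_coeffMap_linear]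

variable (L) in
/-- Multiplication by `r : R` on a right module over the `R`-algebra `A`. -/
abbrev homothety (r : R) : L →ₗ[Aᵐᵒᵖ] L := r • LinearMap.id

/-- If `L / r L` and the `r`-torsion of `L` have acyclic tensor product with `p F`, then `r` acts
surjectively on the homology of `L ⊗ p F`. -/
theorem exists_eq_boundary_add_smul (h : IsDifferentialOn D p) (r : R)
    (hker : CoeffAcyclic D p (LinearMap.ker (homothety (A := A) L r)))
    (hquot : CoeffAcyclic D p (L ⧸ LinearMap.range (homothety (A := A) L r)))
    {z : B →₀ L} (hz : coeffMap L D z = 0) :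
    ∃ w y : B →₀ L, coeffMap L D y = 0 ∧ coeffMap L p z = coeffMap L D w + r • y := by
  obtain ⟨w, hw⟩ := hquot.of_quotient (z := z) (fun b => by rw [hz]; exact zero_mem _)
  obtain ⟨y, hy⟩ := exists_mapRange_eq (homothety (A := A) L r).toAddMonoidHom
    (coeffMap L p z - coeffMap L D w) hw
  have hy' : r • y = coeffMap L p z - coeffMap L D w := by rw [← hy]; ext; simp
  have hry : r • coeffMap L D y = 0 := by
    rw [← coeffMap_smul, hy', map_sub, h.coeff_D_p, h.coeff_D_D, hz, sub_zero]
  obtain ⟨v, hv, hv'⟩ := hker.of_submodule (h.coeff_D_D y) fun b => by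
    simpa using DFunLike.congr_fun hry b
  have hrv : r • v = 0 := by ext b; simpa using hv' b
  refine ⟨w, y - v, ?_, ?_⟩
  · rw [map_sub, hv, h.coeff_p_D, sub_self]
  · rw [smul_sub, hy', hrv]; abel

/-- If `L / r L` and the `r`-torsion of `L` have acyclic tensor product with `p F`, then `r` acts
injectively on the homology of `L ⊗ p F`. -/
theorem exists_eq_boundary_of_smul (h : IsDifferentialOn D p) (r : R)
    (hker : CoeffAcyclic D p (LinearMap.ker (homothety (A := A) L r)))
    (hquot : CoeffAcyclic D p (L ⧸ LinearMap.range (homothety (A := A) L r)))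
    {z w : B →₀ L} (hz : coeffMap L D z = 0) (hw : r • coeffMap L p z = coeffMap L D w) :
    ∃ v, coeffMap L D v = coeffMap L p z := by
  obtain ⟨v, hv⟩ := hquot.of_quotient (z := w) fun b => by
    rw [← hw]
    exact ⟨coeffMap L p z b, by simp⟩
  obtain ⟨y, hy⟩ := exists_mapRange_eq (homothety (A := A) L r).toAddMonoidHom
    (coeffMap L p w - coeffMap L D v) hv
  have hy' : r • y = coeffMap L p w - coeffMap L D v := by rw [← hy]; ext; simp
  have hDw : coeffMap L D w = r • coeffMap L D y := by
    rw [← coeffMap_smul, hy', map_sub, h.coeff_D_p, h.coeff_D_D, sub_zero]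
  obtain ⟨v', hv', -⟩ := hker.of_submodule (z := coeffMap L p z - coeffMap L D y)
    (by rw [map_sub, h.coeff_D_p, h.coeff_D_D, hz, sub_zero])
    fun b => by
      have : r • (coeffMap L p z - coeffMap L D y) = 0 := by rw [smul_sub, hw, hDw, sub_self]
      simpa using DFunLike.congr_fun this b
  refine ⟨v' + y, ?_⟩
  rw [map_add, hv', map_sub, h.coeff_p_p, h.coeff_p_D, sub_add_cancel]

variable (R) in
/-- Noetherian induction over the ideals of `R` annihilating `L`. For a maximal counterexample the
elements outside the annihilator act bijectively on the homology of `L ⊗ p F`, hence the annihilator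
is a prime ideal and it is enough that the homology vanishes after inverting its complement. -/
theorem coeffAcyclic_of_primes [IsNoetherianRing R] [Module.Finite R A]
    (h : IsDifferentialOn D p)
    (hprime : ∀ (P : Ideal R) [P.IsPrime] (L : Type u) [AddCommGroup L] [Module R L]
      [Module Aᵐᵒᵖ L] [IsScalarTower R Aᵐᵒᵖ L], (∀ a ∈ P, ∀ l : L, a • l = 0) →
      ∀ z : B →₀ L, coeffMap L D z = 0 → ∃ r ∉ P, ∃ w, r • coeffMap L p z = coeffMap L D w)
    (L : Type u) [AddCommGroup L] [Module R L] [Module Aᵐᵒᵖ L] [IsScalarTower R Aᵐᵒᵖ L]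
    [Module.Finite Aᵐᵒᵖ L] : CoeffAcyclic D p L := by
  have hfin : Module.Finite R Aᵐᵒᵖ := Module.Finite.equiv (MulOpposite.opLinearEquiv R)
  have hnoeth : IsNoetherianRing Aᵐᵒᵖ := IsNoetherianRing.of_finite R Aᵐᵒᵖ
  suffices H : ∀ (I : Ideal R) (L : Type u) [AddCommGroup L] [Module R L] [Module Aᵐᵒᵖ L]
      [IsScalarTower R Aᵐᵒᵖ L] [Module.Finite Aᵐᵒᵖ L], (∀ a ∈ I, ∀ l : L, a • l = 0) →
      CoeffAcyclic D p L by
    exact H ⊥ L (by simp)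
  intro I
  induction I using WellFoundedGT.induction with | ind I ih => ?_
  intro L _ _ _ _ _ hL
  have hlt {r : R} (hr : r ∉ I) : I < I ⊔ Ideal.span {r} :=
    left_lt_sup.2 fun hle => hr (hle (Ideal.mem_span_singleton_self r))
  have hkill {r : R} {M : Type u} [AddCommGroup M] [Module R M] (h1 : ∀ a ∈ I, ∀ l : M, a • l = 0)
      (h2 : ∀ l : M, r • l = 0) : ∀ a ∈ I ⊔ Ideal.span {r}, ∀ l : M, a • l = 0 := by
    intro a ha l
    obtain ⟨b, hb, c, hc, rfl⟩ := Submodule.mem_sup.1 ha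
    obtain ⟨c, rfl⟩ := Ideal.mem_span_singleton'.1 hc
    rw [add_smul, h1 b hb, mul_smul, h2, smul_zero, add_zero]
  have hker {r : R} (hr : r ∉ I) : CoeffAcyclic D p (LinearMap.ker (homothety (A := A) L r)) :=
    ih _ (hlt hr) _ <| hkill (fun a ha l => Subtype.ext (hL a ha l.1))
      fun l => Subtype.ext (LinearMap.mem_ker.1 l.2)
  have hquot {r : R} (hr : r ∉ I) :
      CoeffAcyclic D p (L ⧸ LinearMap.range (homothety (A := A) L r)) := by
    refine ih _ (hlt hr) _ <| hkill (fun a ha l => ?_) fun l => ?_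
    · obtain ⟨l, rfl⟩ := Submodule.Quotient.mk_surjective _ l
      rw [← Submodule.Quotient.mk_smul, hL a ha, Submodule.Quotient.mk_zero]
    · obtain ⟨l, rfl⟩ := Submodule.Quotient.mk_surjective _ l
      rw [← Submodule.Quotient.mk_smul, Submodule.Quotient.mk_eq_zero]
      exact ⟨l, by simp⟩
  intro z hz
  by_cases hI : I.IsPrime
  · obtain ⟨r, hr, w, hw⟩ := hprime I L hL z hz
    exact exists_eq_boundary_of_smul h r (hker hr) (hquot hr) hz hw
  · rw [Ideal.not_isPrime_iff] at hI
    obtain rfl | ⟨r, hr, s, hs, hrs⟩ := hI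
    · refine ⟨0, ?_⟩
      have : z = 0 := by ext b; simpa using hL 1 trivial (z b)
      simp [this]
    · obtain ⟨w, y, hy, hw⟩ := exists_eq_boundary_add_smul h r (hker hr) (hquot hr) hz
      obtain ⟨w', y', -, hw'⟩ := exists_eq_boundary_add_smul h s (hker hs) (hquot hs) hy
      refine ⟨w + r • w', ?_⟩
      have hzero : (r * s) • y' = 0 := by ext b; simpa using hL _ hrs (y' b)
      calc coeffMap L D (w + r • w') = coeffMap L D w + r • (coeffMap L D w' + s • y') := by
            rw [smul_add, smul_smul, hzero, map_add, coeffMap_smul, add_zero]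
        _ = coeffMap L p (coeffMap L D w + r • y) := by
            rw [← hw', map_add, coeffMap_smul, h.coeff_p_D]
        _ = coeffMap L p z := by rw [← hw, h.coeff_p_p]

end Devissage

/-! ### Coefficients in the residue fields -/

section ResidueField

section RightModule

variable {R A k : Type u} [CommRing R] [Ring A] [Algebra R A] [CommRing k] [Algebra R k]
  {L : Type u} [AddCommGroup L] [Module R L] [Module Aᵐᵒᵖ L] [IsScalarTower R Aᵐᵒᵖ L]

variable (R A k L) in
/-- The right `A ⊗ k`-action on `L ⊗ k`, for a right `A`-module `L`, as a homomorphism to the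
`R`-linear endomorphisms. -/
noncomputable def tensorRightAction : (A ⊗[R] k)ᵐᵒᵖ →ₐ[R] Module.End R (L ⊗[R] k) :=
  ((Module.endTensorEndAlgHom (R := R) (S := R) (A := R) (M := L) (N := k)).comp
    (Algebra.TensorProduct.map (Algebra.lsmul R R L : Aᵐᵒᵖ →ₐ[R] _)
      (Algebra.lsmul R R k : kᵐᵒᵖ →ₐ[R] _))).comp
    (Algebra.TensorProduct.opAlgEquiv R R A k).symm.toAlgHom

variable (R A k L) in
/-- The right `A ⊗ k`-module `L ⊗ k`, for a right `A`-module `L`. -/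
@[reducible]
noncomputable def tensorRightModule : Module (A ⊗[R] k)ᵐᵒᵖ (L ⊗[R] k) :=
  Module.compHom (L ⊗[R] k) (tensorRightAction R A k L).toRingHom

theorem tensorRightAction_tmul (a : A) (c : k) (l : L) (x : k) :
    tensorRightAction R A k L (op (a ⊗ₜ c)) (l ⊗ₜ x) = (op a • l) ⊗ₜ (x * c) := rfl

end RightModule

variable {R A : Type u} [CommRing R] [Ring A] [Algebra R A] {B : Type u}
  (P : Ideal R) [P.IsPrime]

theorem prod_notMem_of_isPrime {ι : Type*} (s : Finset ι) (r : ι → R) (hr : ∀ i, r i ∉ P) :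
    ∏ i ∈ s, r i ∉ P := fun h =>
  let ⟨i, _, hi⟩ := (Ideal.IsPrime.prod_mem_iff (p := P)).1 h
  hr i hi

theorem exists_smul_mem_range_algebraMap (x : P.ResidueField) :
    ∃ r ∉ P, ∃ s : R, r • x = algebraMap R P.ResidueField s := by
  obtain ⟨a, b, hb, rfl⟩ := IsFractionRing.div_surjective (A := R ⧸ P) x
  obtain ⟨a, rfl⟩ := Ideal.Quotient.mk_surjective a
  obtain ⟨b, rfl⟩ := Ideal.Quotient.mk_surjective b
  have hb0 : algebraMap (R ⧸ P) P.ResidueField (Ideal.Quotient.mk P b) ≠ 0 :=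
    IsFractionRing.to_map_ne_zero_of_mem_nonZeroDivisors hb
  refine ⟨b, fun h => hb0 ?_, a, ?_⟩
  · rw [Ideal.Quotient.eq_zero_iff_mem.2 h, map_zero]
  · rw [Algebra.smul_def, IsScalarTower.algebraMap_apply R (R ⧸ P) P.ResidueField b,
      IsScalarTower.algebraMap_apply R (R ⧸ P) P.ResidueField a]
    exact mul_div_cancel₀ _ hb0

section Module

variable {L : Type u} [AddCommGroup L] [Module R L]

theorem exists_smul_eq_tmul_one (x : L ⊗[R] P.ResidueField) :
    ∃ r ∉ P, ∃ l : L, r • x = l ⊗ₜ 1 := by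
  induction x with
  | zero => exact ⟨1, P.one_notMem, 0, by simp⟩
  | tmul l c =>
    obtain ⟨r, hr, s, hs⟩ := exists_smul_mem_range_algebraMap P c
    refine ⟨r, hr, s • l, ?_⟩
    rw [← TensorProduct.tmul_smul, hs, TensorProduct.smul_tmul, Algebra.smul_def, mul_one]
  | add x y hx hy =>
    obtain ⟨r, hr, l, hl⟩ := hx
    obtain ⟨s, hs, m, hm⟩ := hy
    refine ⟨r * s, fun h => (Ideal.IsPrime.mem_or_mem ‹_› h).elim hr hs, s • l + r • m, ?_⟩
    rw [smul_add, mul_comm, mul_smul, hl, mul_comm, mul_smul, hm, TensorProduct.add_tmul,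
      TensorProduct.smul_tmul', TensorProduct.smul_tmul']

theorem exists_smul_eq_zero_of_tmul_one (hL : ∀ a ∈ P, ∀ l : L, a • l = 0) (l : L)
    (hl : l ⊗ₜ[R] (1 : P.ResidueField) = 0) : ∃ r ∉ P, r • l = 0 := by
  have htors : Module.IsTorsionBySet R L P := fun l a => hL a a.2 l
  let : Module (R ⧸ P) L := htors.module
  have : IsScalarTower R (R ⧸ P) L := htors.isScalarTower
  have h : TensorProduct.mk (R ⧸ P) P.ResidueField L 1 l = 0 := by
    have h := congr(TensorProduct.mapOfCompatibleSMul (R ⧸ P) R R L P.ResidueField $hl)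
    rw [TensorProduct.mapOfCompatibleSMul_tmul, map_zero] at h
    simpa using congr(TensorProduct.comm (R ⧸ P) _ _ $h)
  rw [IsLocalizedModule.eq_zero_iff (nonZeroDivisors (R ⧸ P))] at h
  obtain ⟨⟨c, hc⟩, h⟩ := h
  obtain ⟨r, rfl⟩ := Ideal.Quotient.mk_surjective c
  refine ⟨r, fun hr => nonZeroDivisors.ne_zero hc (Ideal.Quotient.eq_zero_iff_mem.2 hr), ?_⟩
  rw [← h]
  exact (algebraMap_smul (R ⧸ P) r l).symm

theorem exists_smul_eq_mapRange (g : L →ₗ[R] L ⊗[R] P.ResidueField) (hg : ∀ l, g l = l ⊗ₜ 1)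
    (w : B →₀ L ⊗[R] P.ResidueField) :
    ∃ r ∉ P, ∃ v : B →₀ L, r • w = v.mapRange g g.map_zero := by
  classical
  choose r hr l hl using exists_smul_eq_tmul_one P (L := L)
  refine ⟨∏ b ∈ w.support, r (w b), prod_notMem_of_isPrime P _ _ fun _ => hr _, ?_⟩
  obtain ⟨v, hv⟩ := exists_mapRange_eq g.toAddMonoidHom ((∏ b ∈ w.support, r (w b)) • w) fun b => by
    by_cases hb : b ∈ w.support
    · refine ⟨(∏ b ∈ w.support.erase b, r (w b)) • l (w b), ?_⟩
      rw [← Finset.mul_prod_erase _ _ hb, mul_comm]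
      simp only [LinearMap.toAddMonoidHom_coe, Finsupp.smul_apply, mul_smul, hl, hg,
        TensorProduct.smul_tmul']
    · exact ⟨0, by simp [Finsupp.notMem_support_iff.1 hb]⟩
  exact ⟨v, hv.symm⟩

theorem exists_smul_eq_zero_of_mapRange (hL : ∀ a ∈ P, ∀ l : L, a • l = 0)
    (g : L →ₗ[R] L ⊗[R] P.ResidueField) (hg : ∀ l, g l = l ⊗ₜ 1) (x : B →₀ L)
    (hx : x.mapRange g g.map_zero = 0) : ∃ r ∉ P, r • x = 0 := by
  classical
  have h (b : B) : ∃ r ∉ P, r • x b = 0 :=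
    exists_smul_eq_zero_of_tmul_one P hL _ (by rw [← hg]; exact DFunLike.congr_fun hx b)
  choose r hr hrx using h
  refine ⟨∏ b ∈ x.support, r b, prod_notMem_of_isPrime P _ _ hr, ?_⟩
  ext b
  by_cases hb : b ∈ x.support
  · rw [← Finset.mul_prod_erase _ _ hb, mul_comm, Finsupp.smul_apply, mul_smul, hrx, smul_zero]
    rfl
  · simp [Finsupp.notMem_support_iff.1 hb]

end Module

/-- A contraction of `p F ⊗ k(P)` over `A ⊗ k(P)` makes the homology of `L ⊗ p F` vanish after
inverting the complement of `P`, for every right `A`-module `L` annihilated by `P`. -/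
theorem exists_smul_eq_boundary_of_contraction {D p : (B →₀ A) →ₗ[A] (B →₀ A)}
    {D' p' H' : (B →₀ A ⊗[R] P.ResidueField) →ₗ[A ⊗[R] P.ResidueField]
      (B →₀ A ⊗[R] P.ResidueField)}
    (hD : ∀ b, D' (Finsupp.single b 1) = (D (Finsupp.single b 1)).mapRange
      (Algebra.TensorProduct.includeLeftRingHom : A →+* A ⊗[R] P.ResidueField) (map_zero _))
    (hp : ∀ b, p' (Finsupp.single b 1) = (p (Finsupp.single b 1)).mapRange
      (Algebra.TensorProduct.includeLeftRingHom : A →+* A ⊗[R] P.ResidueField) (map_zero _))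
    (hH : D' ∘ₗ H' + H' ∘ₗ D' = p')
    (L : Type u) [AddCommGroup L] [Module R L] [Module Aᵐᵒᵖ L] [IsScalarTower R Aᵐᵒᵖ L]
    (hL : ∀ a ∈ P, ∀ l : L, a • l = 0) (z : B →₀ L) (hz : coeffMap L D z = 0) :
    ∃ r ∉ P, ∃ w, r • coeffMap L p z = coeffMap L D w := by
  let := tensorRightModule R A P.ResidueField L
  let g : L →ₗ[R] L ⊗[R] P.ResidueField := (TensorProduct.mk R L P.ResidueField).flip 1
  have hg (a : A) (l : L) :
      g (op a • l) =
        op ((Algebra.TensorProduct.includeLeftRingHom : A →+* A ⊗[R] P.ResidueField) a) • g l := by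
    change (op a • l) ⊗ₜ 1 = tensorRightAction R A P.ResidueField L (op (a ⊗ₜ 1)) (l ⊗ₜ 1)
    rw [tensorRightAction_tmul, mul_one]
  have gsmul (r : R) (x : B →₀ L) : (r • x).mapRange g g.map_zero = r • x.mapRange g g.map_zero :=
    Finsupp.mapRange_smul _ _ fun _ => map_smul g _ _
  have cD (x : B →₀ L) := mapRange_coeffMap Algebra.TensorProduct.includeLeftRingHom
    g.toAddMonoidHom hg hD x
  have cp (x : B →₀ L) := mapRange_coeffMap Algebra.TensorProduct.includeLeftRingHom
    g.toAddMonoidHom hg hp x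
  have sD (r : R) (x : B →₀ L ⊗[R] P.ResidueField) :
      coeffMap _ D' (r • x) = r • coeffMap _ D' x := by
    have := mapRange_coeffMap (RingHom.id (A ⊗[R] P.ResidueField))
      (DistribSMul.toAddMonoidHom (L ⊗[R] P.ResidueField) r)
      (fun a l => (map_smul (tensorRightAction R A P.ResidueField L (op a)) r l).symm)
      (φ := D') (φ' := D') (fun b => by ext; simp) x
    have key (y : B →₀ L ⊗[R] P.ResidueField) : y.mapRange
        (DistribSMul.toAddMonoidHom (L ⊗[R] P.ResidueField) r) (map_zero _) = r • y := by
      ext; rfl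
    rw [← key, ← key]
    exact this.symm
  set z' := z.mapRange g g.map_zero with hz'
  have hz0 : coeffMap _ D' z' = 0 := by
    refine (cD z).symm.trans ?_
    rw [hz, Finsupp.mapRange_zero]
  have hw' : coeffMap _ D' (coeffMap _ H' z') = coeffMap _ p' z' := by
    rw [← hH, coeffMap_add, coeffMap_comp, coeffMap_comp, hz0, map_zero, add_zero]
  obtain ⟨r, hr, w, hw⟩ := exists_smul_eq_mapRange P g (fun _ => rfl) (coeffMap _ H' z')
  obtain ⟨s, hs, h⟩ := exists_smul_eq_zero_of_mapRange P hL g (fun _ => rfl)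
    (r • coeffMap L p z - coeffMap L D w) (by
      have e1 : (r • coeffMap L p z).mapRange g g.map_zero = r • coeffMap _ p' z' := by
        rw [gsmul]; exact congrArg _ (cp z)
      have e2 : (coeffMap L D w).mapRange g g.map_zero = r • coeffMap _ p' z' := by
        refine (cD w).trans ?_
        rw [← hw', ← sD, hw]
        rfl
      rw [Finsupp.mapRange_sub (fun _ _ => map_sub g _ _), e1, e2, sub_self])
  refine ⟨s * r, fun h => (Ideal.IsPrime.mem_or_mem ‹_› h).elim hs hr, s • w, ?_⟩
  rw [coeffMap_smul, mul_smul, ← sub_eq_zero, ← smul_sub, h]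

end ResidueField

/-! ### Local contractions -/

section LocalContraction

variable {A : Type u} [Ring A] {B : Type u} {D p : (B →₀ A) →ₗ[A] (B →₀ A)}

/-- If the tensor product of `p F` with every finitely generated right submodule `U ⊆ A^k` is
acyclic, then finitely many cycles are boundaries by means of one linear map `s`. The cycles
`z₁, …, z_k` are the components of a single cycle of `U ⊗ F`, where `U ⊆ A^k` is generated by the
columns of their coefficient matrix, and `s` is read off from a bounding chain in `U ⊗ F`. -/
theorem exists_localContraction_fin {k : ℕ}
    (hU : ∀ U : Submodule Aᵐᵒᵖ (Fin k → A), U.FG → CoeffAcyclic D p U)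
    (z : Fin k → B →₀ A) (hz : ∀ i, D (z i) = 0) :
    ∃ s : (B →₀ A) →ₗ[A] (B →₀ A), ∀ i, D (s (z i)) = p (z i) := by
  classical
  let Z : B →₀ (Fin k → A) := Finsupp.onFinset (Finset.univ.biUnion fun i => (z i).support)
    (fun b i => z i b) fun b hb => by
      obtain ⟨i, hi⟩ := Function.ne_iff.1 hb
      exact Finset.mem_biUnion.2 ⟨i, Finset.mem_univ i, Finsupp.mem_support_iff.2 hi⟩
  have hZ (b : B) (i : Fin k) : Z b i = z i b := rfl
  let pr (i : Fin k) : (Fin k → A) →ₗ[Aᵐᵒᵖ] A := LinearMap.proj i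
  have hpr (i : Fin k) : Z.mapRange (pr i) (map_zero _) = z i := by ext b; rfl
  have hcomp (φ : (B →₀ A) →ₗ[A] (B →₀ A)) (x : B →₀ (Fin k → A)) (i : Fin k) :
      (coeffMap _ φ x).mapRange (pr i) (map_zero _) = φ (x.mapRange (pr i) (map_zero _)) := by
    rw [mapRange_coeffMap_linear, coeffMap_self]
  let U : Submodule Aᵐᵒᵖ (Fin k → A) := Submodule.span Aᵐᵒᵖ (Set.range Z)
  have hfin : (Set.range Z).Finite :=
    ((Z.support.finite_toSet.image Z).insert 0).subset <| by
      rintro _ ⟨b, rfl⟩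
      by_cases hb : b ∈ Z.support
      · exact Or.inr ⟨b, hb, rfl⟩
      · exact Or.inl (Finsupp.notMem_support_iff.1 hb)
  have hDZ : coeffMap _ D Z = 0 := by
    ext b i
    have := DFunLike.congr_fun (hcomp D Z i) b
    rw [hpr, hz] at this
    exact this
  -- `Z` has values in `U`, so it bounds in `U ⊗ F`
  obtain ⟨Y, hY⟩ := exists_mapRange_eq U.subtype.toAddMonoidHom Z fun b =>
    ⟨⟨Z b, Submodule.subset_span ⟨b, rfl⟩⟩, rfl⟩
  have hY' : Y.mapRange U.subtype (map_zero _) = Z := hY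
  obtain ⟨w', hw'⟩ := hU U (Submodule.fg_span hfin) Y <| by
    apply Finsupp.mapRange_injective U.subtype (map_zero _) Subtype.val_injective
    rw [mapRange_coeffMap_linear, hY', hDZ, Finsupp.mapRange_zero]
  let w : B →₀ (Fin k → A) := w'.mapRange U.subtype (map_zero _)
  have hw : coeffMap _ D w = coeffMap _ p Z := by
    rw [← mapRange_coeffMap_linear, hw', mapRange_coeffMap_linear, hY']
  have hy (b : B) : ∃ y : B →₀ Aᵐᵒᵖ, (y.sum fun i c => c • Z i) = w b :=
    Finsupp.mem_span_range_iff_exists_finsupp.1 (w' b).2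
  choose y hy using hy
  let s : (B →₀ A) →ₗ[A] (B →₀ A) := Finsupp.linearCombination A fun b' =>
    ∑ b ∈ w.support, Finsupp.single b (unop (y b b'))
  have hs (i : Fin k) : s (z i) = w.mapRange (pr i) (map_zero _) := by
    ext b
    have e : s (z i) b = (z i).sum fun b' a => a * (if b ∈ w.support then unop (y b b') else 0) := by
      rw [Finsupp.linearCombination_apply, Finsupp.sum_apply]
      refine Finsupp.sum_congr fun b' _ => ?_
      rw [Finsupp.smul_apply, Finsupp.finsetSum_apply]
      simp [Finsupp.single_apply]
    rw [e]
    by_cases hb : b ∈ w.support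
    · have e2 : w b i = (y b).sum fun b' c => z i b' * unop c := by
        rw [← hy b, Finsupp.sum, Finset.sum_apply]
        rfl
      simp only [hb, if_true, Finsupp.mapRange_apply]
      change _ = w b i
      rw [e2, Finsupp.sum_of_support_subset (z i) Finset.subset_union_left _ (by simp)
        (s := (z i).support ∪ (y b).support),
        Finsupp.sum_of_support_subset (y b) Finset.subset_union_right _ (by simp)
        (s := (z i).support ∪ (y b).support)]
    · simp only [hb, if_false, mul_zero, Finsupp.mapRange_apply, Finsupp.notMem_support_iff.1 hb]
      simp
  refine ⟨s, fun i => ?_⟩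
  rw [hs, ← hcomp, hw, hcomp, hpr]

theorem exists_localContraction
    (hU : ∀ (k : ℕ) (U : Submodule Aᵐᵒᵖ (Fin k → A)), U.FG → CoeffAcyclic D p U)
    (N : Submodule A (B →₀ A)) (hN : N.FG) (hND : ∀ z ∈ N, D z = 0) :
    ∃ s : (B →₀ A) →ₗ[A] (B →₀ A), ∀ z ∈ N, D (s z) = p z := by
  obtain ⟨k, z, rfl⟩ := Submodule.fg_iff_exists_fin_generating_family.1 hN
  obtain ⟨s, hs⟩ := exists_localContraction_fin (hU k) z
    fun i => hND _ (Submodule.subset_span ⟨i, rfl⟩)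
  refine ⟨s, fun x hx => ?_⟩
  have : Set.EqOn (D ∘ₗ s) p (Submodule.span A (Set.range z)) :=
    LinearMap.eqOn_span' (by rintro _ ⟨i, rfl⟩; exact hs i)
  exact this hx

end LocalContraction

/-! ### Local contractions on countable exhaustions -/

section Exhaustion

open Filter

variable {A : Type*} [Ring A] {K : Type*} [AddCommGroup K] [Module A K]

/-- The limit of a pointwise eventually constant sequence of linear maps. -/
theorem exists_linearMap_of_eventually_eq {M : Type*} [AddCommGroup M] [Module A M]
    (u : ℕ → M →ₗ[A] K) (hu : ∀ x, ∃ v, ∀ᶠ n in atTop, u n x = v) :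
    ∃ v : M →ₗ[A] K, ∀ x, ∀ᶠ n in atTop, u n x = v x := by
  choose v hv using hu
  refine ⟨{ toFun := v, map_add' := fun x y => ?_, map_smul' := fun a x => ?_ }, hv⟩
  · obtain ⟨n, h1, h2, h3⟩ := ((hv (x + y)).and ((hv x).and (hv y))).exists
    rw [← h1, ← h2, ← h3, map_add]
  · obtain ⟨n, h1, h2⟩ := ((hv (a • x)).and (hv x)).exists
    rw [← h1, ← h2, map_smul, RingHom.id_apply]

/-- A differential module that is exhausted by a sequence of finitely generated submodules on each
of which all cycles bound by means of a linear map `s j` is contractible. With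
`α (k + 1) = (1 - D s) α k`, for suitable `s = s (j k)`, the sum `∑ s α k` is finite on every cycle,
and telescopes to a linear section of `D` over the cycles. -/
theorem exists_contraction_of_exhaustion (D : K →ₗ[A] K) (hD : ∀ x, D (D x) = 0)
    (F : ℕ → Submodule A K) (hmono : Monotone F) (hfg : ∀ j, (F j).FG) (hF : ∀ x, ∃ j, x ∈ F j)
    (s : ℕ → K →ₗ[A] K) (hs : ∀ j, ∀ z ∈ F j, D z = 0 → D (s j z) = z) :
    ∃ h : K →ₗ[A] K, ∀ x, D (h x) + h (D x) = x := by
  have hj (α : K →ₗ[A] K) (k : ℕ) : ∃ j, ∀ x ∈ F k, α x ∈ F j := by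
    obtain ⟨S, hS⟩ := hfg k
    have hev : ∀ x ∈ S, ∀ᶠ j in atTop, α x ∈ F j := fun x _ => by
      obtain ⟨j, hj⟩ := hF (α x)
      exact (eventually_ge_atTop j).mono fun i hi => hmono hi hj
    obtain ⟨j, hj⟩ := ((eventually_all_finset S).2 hev).exists
    refine ⟨j, fun x hx => ?_⟩
    have hle : F k ≤ (F j).comap α := hS ▸ Submodule.span_le.2 hj
    exact hle hx
  choose j hj using hj
  let α : ℕ → K →ₗ[A] K := fun n =>
    Nat.rec LinearMap.id (fun k αk => αk - D ∘ₗ s (j αk k) ∘ₗ αk) n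
  have hα (k : ℕ) (x : K) : α (k + 1) x = α k x - D (s (j (α k) k) (α k x)) := rfl
  have hαD (k : ℕ) {z : K} (hz : D z = 0) : D (α k z) = 0 := by
    induction k with
    | zero => exact hz
    | succ k ih => rw [hα, map_sub, ih, hD, sub_zero]
  have hvanish {k : ℕ} {z : K} (hz : D z = 0) (hk : z ∈ F k) (n : ℕ) : α (k + 1 + n) z = 0 := by
    induction n with
    | zero => rw [add_zero, hα, hs _ _ (hj _ _ _ hk) (hαD k hz), sub_self]
    | succ n ih => rw [← add_assoc, hα, ih, map_zero, map_zero, sub_zero]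
  let σ (n : ℕ) : K →ₗ[A] K := ∑ k ∈ Finset.range n, s (j (α k) k) ∘ₗ α k
  have hσ (n : ℕ) (x : K) : σ (n + 1) x = σ n x + s (j (α n) n) (α n x) := by
    simp [σ, Finset.sum_range_succ]
  have hDσ (n : ℕ) (x : K) : D (σ n x) = x - α n x := by
    induction n with
    | zero => simp [σ, α]
    | succ n ih => rw [hσ, map_add, ih, hα]; abel
  have hev (z : LinearMap.ker D) : ∀ᶠ n in atTop, α n z = 0 := by
    obtain ⟨k, hk⟩ := hF z
    filter_upwards [eventually_ge_atTop (k + 1)] with n hn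
    obtain ⟨m, rfl⟩ := Nat.exists_eq_add_of_le hn
    exact hvanish z.2 hk m
  obtain ⟨t, ht⟩ := exists_linearMap_of_eventually_eq
    (fun n => σ n ∘ₗ (LinearMap.ker D).subtype) fun z => by
      obtain ⟨k, hk⟩ := eventually_atTop.1 (hev z)
      refine ⟨σ k z, (eventually_ge_atTop k).mono fun n hn => ?_⟩
      induction n, hn using Nat.le_induction with
      | base => rfl
      | succ n hn ih =>
        change σ (n + 1) z = _
        rw [hσ, hk n hn, map_zero, add_zero]
        exact ih
  have hDt (z : LinearMap.ker D) : D (t z) = z := by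
    obtain ⟨n, h1, h2⟩ := ((ht z).and (hev z)).exists
    rw [← h1]
    change D (σ n z) = z
    rw [hDσ, h2, sub_zero]
  -- the standard contraction attached to a section of `D` over the cycles
  let d : K →ₗ[A] LinearMap.ker D := D.codRestrict _ hD
  let e : K →ₗ[A] LinearMap.ker D := (LinearMap.id - t ∘ₗ d).codRestrict _ fun x => by
    change D (x - t (d x)) = 0
    rw [map_sub, hDt, sub_eq_zero]
    rfl
  refine ⟨t ∘ₗ e, fun x => ?_⟩
  have h1 : e (D x) = d x := by
    have : d (D x) = 0 := Subtype.ext (hD x)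
    ext
    change D x - t (d (D x)) = D x
    rw [this, map_zero, sub_zero]
  change D (t (e x)) + t (e (D x)) = x
  rw [hDt, h1]
  change x - t (d x) + t (d x) = x
  rw [sub_add_cancel]

end Exhaustion

section Closure

open Filter

theorem exists_countable_closed {B : Type*} (f : Finset B → B → Finset B) (b : B) :
    ∃ T : Set B, T.Countable ∧ b ∈ T ∧
      ∀ T₀ : Finset B, (T₀ : Set B) ⊆ T → ∀ x ∈ T, (f T₀ x : Set B) ⊆ T := by
  classical
  let step (U : Set B) : Set B :=
    U ∪ ⋃ (V : Finset U) (x : U), (f (V.map (Function.Embedding.subtype _)) x : Set B)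
  have hle (U : Set B) : U ⊆ step U := Set.subset_union_left
  have hcount (U : Set B) (hU : U.Countable) : (step U).Countable := by
    have := hU.to_subtype
    exact hU.union (Set.countable_iUnion fun V => Set.countable_iUnion fun x =>
      (Finset.countable_toSet _))
  let T : ℕ → Set B := fun n => step^[n] {b}
  have hT (n : ℕ) : T (n + 1) = step (T n) := Function.iterate_succ_apply' _ _ _
  have hmono : Monotone T := monotone_nat_of_le_succ fun n => by rw [hT]; exact hle _
  have hev {x : B} (hx : x ∈ ⋃ n, T n) : ∀ᶠ n in atTop, x ∈ T n := by
    obtain ⟨n, hn⟩ := Set.mem_iUnion.1 hx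
    exact (eventually_ge_atTop n).mono fun m hm => hmono hm hn
  refine ⟨⋃ n, T n, Set.countable_iUnion fun n => ?_, Set.mem_iUnion.2 ⟨0, rfl⟩,
    fun T₀ hT₀ x hx y hy => ?_⟩
  · induction n with
    | zero => exact Set.countable_singleton b
    | succ n ih => rw [hT]; exact hcount _ ih
  · obtain ⟨n, hn, hxn⟩ :=
      (((eventually_all_finset T₀).2 fun z hz => hev (hT₀ hz)).and (hev hx)).exists
    refine Set.mem_iUnion.2 ⟨n + 1, ?_⟩
    rw [hT]
    refine Or.inr (Set.mem_iUnion₂.2 ⟨T₀.subtype (· ∈ T n), ⟨x, hxn⟩, ?_⟩)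
    have e : (T₀.subtype (· ∈ T n)).map (Function.Embedding.subtype _) = T₀ :=
      Finset.subtype_map_of_mem hn
    rw [e]
    exact hy

end Closure

/-! ### Gluing contractions of subcomplexes -/

section Extension

open Filter

variable {A : Type u} [Ring A] {B : Type u}

theorem exists_projection_supported (S : Set B) : ∃ q : (B →₀ A) →ₗ[A] (B →₀ A),
    (∀ x, q x ∈ Finsupp.supported A A S) ∧ ∀ x ∈ Finsupp.supported A A S, q x = x := by
  classical
  refine ⟨(Finsupp.supported A A S).subtype ∘ₗ Finsupp.restrictDom A A S,
    fun x => (Finsupp.restrictDom A A S x).2, fun x hx => ?_⟩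
  exact (Finsupp.filter_eq_self_iff _ _).2 fun b hb =>
    (Finsupp.mem_supported _ _).1 hx (Finsupp.mem_support_iff.2 hb)

theorem map_mem_of_single_mem {M : Type*} [AddCommGroup M] [Module A M] {S : Set B}
    {N : Submodule A M} {φ : (B →₀ A) →ₗ[A] M} (h : ∀ b ∈ S, φ (Finsupp.single b 1) ∈ N)
    {x : B →₀ A} (hx : x ∈ Finsupp.supported A A S) : φ x ∈ N := by
  rw [Finsupp.supported_eq_span_single] at hx
  have : Submodule.span A ((fun i => Finsupp.single i (1 : A)) '' S) ≤ N.comap φ :=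
    Submodule.span_le.2 (by rintro _ ⟨b, hb, rfl⟩; exact h b hb)
  exact this hx

/-- The free submodule `A^(S)` of `F = A^(B)` is stable under the differential `D` and the
idempotent `p`, and `H` restricts to a contraction of the complex `p A^(S)`, extended by zero to the
complement. The endomorphism `H` is arbitrary outside `A^(S)`. -/
structure IsContractionOn (D p : (B →₀ A) →ₗ[A] (B →₀ A)) (S : Set B)
    (H : (B →₀ A) →ₗ[A] (B →₀ A)) : Prop where
  D_mem : ∀ x ∈ Finsupp.supported A A S, D x ∈ Finsupp.supported A A S
  p_mem : ∀ x ∈ Finsupp.supported A A S, p x ∈ Finsupp.supported A A S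
  H_mem : ∀ x ∈ Finsupp.supported A A S, H x ∈ Finsupp.supported A A S
  p_H : ∀ x ∈ Finsupp.supported A A S, p (H x) = H x
  H_p : ∀ x ∈ Finsupp.supported A A S, H (p x) = H x
  contr : ∀ x ∈ Finsupp.supported A A S, D (H x) + H (D x) = p x

/-- A contraction on `A^(S)` extends to `A^(S ∪ T)` for some countable `T` containing a given
element. The contraction splits `p A^(S)` off as a direct factor of the complex `p F`; let `c` be the
projection to the complement. For a countable set `T` closed under enough local contractions, the
complex `c A^(T)` is contractible, and it is a complement of `p A^(S)` in `p A^(S ∪ T)`. -/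
theorem IsContractionOn.exists_extension [IsNoetherianRing A]
    {D p : (B →₀ A) →ₗ[A] (B →₀ A)} (hDD : ∀ x, D (D x) = 0) (hpD : ∀ x, p (D x) = D x)
    (hDp : ∀ x, D (p x) = D x) (hpp : ∀ x, p (p x) = p x)
    (hloc : ∀ N : Submodule A (B →₀ A), N.FG → (∀ z ∈ N, D z = 0) →
      ∃ s : (B →₀ A) →ₗ[A] (B →₀ A), ∀ z ∈ N, D (s z) = p z)
    {S : Set B} {H : (B →₀ A) →ₗ[A] (B →₀ A)} (hS : IsContractionOn D p S H) (b₀ : B) :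
    ∃ (T : Set B) (H' : (B →₀ A) →ₗ[A] (B →₀ A)), b₀ ∈ T ∧ IsContractionOn D p (S ∪ T) H' ∧
      ∀ x ∈ Finsupp.supported A A S, H' x = H x := by
  classical
  obtain ⟨q, hq, hq'⟩ := exists_projection_supported (A := A) S
  -- `E` extends the contraction of `p A^(S)` to `F`, and `e` is a chain retraction to `p A^(S)`
  let E : (B →₀ A) →ₗ[A] (B →₀ A) := H ∘ₗ q ∘ₗ p
  have hEdef (x) : E x = H (q (p x)) := rfl
  have hES (x) : E x ∈ Finsupp.supported A A S := hS.H_mem _ (hq _)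
  have hpE (x) : p (E x) = E x := hS.p_H _ (hq _)
  have hEp (x) : E (p x) = E x := by rw [hEdef, hpp, hEdef]
  have hEH {x} (hx : x ∈ Finsupp.supported A A S) : E x = H x := by
    rw [hEdef, hq' _ (hS.p_mem _ hx), hS.H_p _ hx]
  let e : (B →₀ A) →ₗ[A] (B →₀ A) := D ∘ₗ E + E ∘ₗ D
  have hedef (x) : e x = D (E x) + E (D x) := rfl
  have heS (x) : e x ∈ Finsupp.supported A A S :=
    add_mem (hS.D_mem _ (hES _)) (hES _)
  have hpe (x) : p (e x) = e x := by rw [hedef, map_add, hpD, hpE]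
  have hep (x) : e (p x) = e x := by rw [hedef, hEp, hDp, hedef]
  have hDe (x) : D (e x) = e (D x) := by
    rw [hedef, hedef, map_add, hDD, hDD, map_zero, zero_add, add_zero]
  have he {x} (hx : x ∈ Finsupp.supported A A S) : e x = p x := by
    rw [hedef, hEH hx, hEH (hS.D_mem _ hx), hS.contr _ hx]
  let c : (B →₀ A) →ₗ[A] (B →₀ A) := p - e
  have hcdef (x) : c x = p x - e x := rfl
  have hcS {x} (hx : x ∈ Finsupp.supported A A S) : c x = 0 := by rw [hcdef, he hx, sub_self]
  have hDc (x) : D (c x) = c (D x) := by rw [hcdef, hcdef, map_sub, hDp, hpD, hDe]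
  have hpc (x) : p (c x) = c x := by rw [hcdef, map_sub, hpp, hpe]
  have hcp (x) : c (p x) = c x := by rw [hcdef, hcdef, hpp, hep]
  have hcc (x) : c (c x) = c x := by
    conv_lhs => rw [hcdef x, map_sub, hcp, hcS (heS x), sub_zero]
  -- local contractions on the cycles of `c A^(V)`, for all finite sets `V`
  have hs (V : Finset B) : ∃ s : (B →₀ A) →ₗ[A] (B →₀ A),
      ∀ z ∈ (Finsupp.supported A A (V : Set B)).map c, D z = 0 → D (s z) = z := by
    have hfg : ((Finsupp.supported A A (V : Set B)).map c).FG := by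
      rw [Finsupp.supported_eq_span_single]
      exact (Submodule.fg_span (V.finite_toSet.image _)).map c
    have := isNoetherian_of_fg_of_noetherian _ hfg
    obtain ⟨s, hs⟩ := hloc ((Finsupp.supported A A (V : Set B)).map c ⊓ LinearMap.ker D)
      (isNoetherian_submodule.1 this _ inf_le_left) fun z hz => hz.2
    refine ⟨s, fun z hz hDz => (hs z ⟨hz, hDz⟩).trans ?_⟩
    obtain ⟨x, -, rfl⟩ := hz
    exact hpc x
  choose s hs using hs
  obtain ⟨T, hTc, hbT, hT⟩ := exists_countable_closed (fun V b =>
    (s V (c (Finsupp.single b 1))).support ∪ ((D (Finsupp.single b 1)).support ∪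
      (p (Finsupp.single b 1)).support)) b₀
  simp only [Finset.coe_union, Set.union_subset_iff] at hT
  have hsup : Finsupp.supported A A (S ∪ T) = Finsupp.supported A A S ⊔ Finsupp.supported A A T :=
    Finsupp.supported_union _ _
  have hSle : Finsupp.supported A A S ≤ Finsupp.supported A A (S ∪ T) :=
    Finsupp.supported_mono Set.subset_union_left
  have hTle : Finsupp.supported A A T ≤ Finsupp.supported A A (S ∪ T) :=
    Finsupp.supported_mono Set.subset_union_right
  have hDT {x} (hx : x ∈ Finsupp.supported A A T) : D x ∈ Finsupp.supported A A T :=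
    map_mem_of_single_mem (fun b hb => (hT ∅ (by simp) b hb).2.1) hx
  have hpT {x} (hx : x ∈ Finsupp.supported A A T) : p x ∈ Finsupp.supported A A T :=
    map_mem_of_single_mem (fun b hb => (hT ∅ (by simp) b hb).2.2) hx
  have hsT {V : Finset B} (hV : (V : Set B) ⊆ T) {x} (hx : x ∈ Finsupp.supported A A T) :
      s V (c x) ∈ Finsupp.supported A A T :=
    map_mem_of_single_mem (φ := s V ∘ₗ c) (fun b hb => (hT V hV b hb).1) hx
  have hmem {φ : (B →₀ A) →ₗ[A] (B →₀ A)}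
      (h1 : ∀ x ∈ Finsupp.supported A A S, φ x ∈ Finsupp.supported A A S)
      (h2 : ∀ x ∈ Finsupp.supported A A T, φ x ∈ Finsupp.supported A A T) :
      ∀ x ∈ Finsupp.supported A A (S ∪ T), φ x ∈ Finsupp.supported A A (S ∪ T) := by
    intro x hx
    rw [hsup] at hx
    obtain ⟨y, hy, z, hz, rfl⟩ := Submodule.mem_sup.1 hx
    rw [map_add]
    exact add_mem (hSle (h1 y hy)) (hTle (h2 z hz))
  let K : Submodule A (B →₀ A) := (Finsupp.supported A A T).map c
  have hcK {x} (hx : x ∈ Finsupp.supported A A (S ∪ T)) : c x ∈ K := by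
    rw [hsup] at hx
    obtain ⟨y, hy, z, hz, rfl⟩ := Submodule.mem_sup.1 hx
    rw [map_add, hcS hy, zero_add]
    exact ⟨z, hz, rfl⟩
  have hKle {x} (hx : x ∈ K) : x ∈ Finsupp.supported A A (S ∪ T) := by
    obtain ⟨y, hy, rfl⟩ := hx
    exact sub_mem (hTle (hpT hy)) (hSle (heS y))
  have hKc {x} (hx : x ∈ K) : c x = x := by
    obtain ⟨y, hy, rfl⟩ := hx
    exact hcc y
  -- the exhaustion of `K = c A^(T)` by the submodules `c A^(V j)`, `V j ⊆ T` finite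
  obtain ⟨g, hg⟩ := hTc.exists_eq_range ⟨b₀, hbT⟩
  let V (j : ℕ) : Finset B := (Finset.range j).image g
  have hVT (j : ℕ) : (V j : Set B) ⊆ T := by
    intro b hb
    obtain ⟨i, -, rfl⟩ := Finset.mem_image.1 (Finset.mem_coe.1 hb)
    rw [hg]
    exact ⟨i, rfl⟩
  have hVmono : Monotone V := fun i j hij =>
    Finset.image_subset_image (Finset.range_mono hij)
  let DK : K →ₗ[A] K := D.restrict (p := K) (q := K) fun x hx => by
    obtain ⟨y, hy, rfl⟩ := hx
    exact ⟨D y, hDT hy, (hDc y).symm⟩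
  let sK (j : ℕ) : K →ₗ[A] K := (c ∘ₗ s (V j)).restrict (p := K) (q := K) fun x hx => by
    obtain ⟨y, hy, rfl⟩ := hx
    exact ⟨_, hsT (hVT j) hy, rfl⟩
  have hVfg (j : ℕ) : ((Finsupp.supported A A (V j : Set B)).map c).FG := by
    rw [Finsupp.supported_eq_span_single]
    exact (Submodule.fg_span ((V j).finite_toSet.image _)).map c
  have hVK (j : ℕ) : (Finsupp.supported A A (V j : Set B)).map c ≤ K :=
    Submodule.map_mono (Finsupp.supported_mono (hVT j))
  have hDK (x : K) : DK (DK x) = 0 := Subtype.ext (hDD x)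
  obtain ⟨h, hh⟩ := exists_contraction_of_exhaustion (K := K) DK hDK
    (fun j => ((Finsupp.supported A A (V j : Set B)).map c).comap K.subtype)
    (fun i j hij => Submodule.comap_mono (Submodule.map_mono
      (Finsupp.supported_mono (Finset.coe_subset.2 (hVmono hij)))))
    (fun j => by
      refine Submodule.fg_of_fg_map_injective K.subtype Subtype.val_injective ?_
      rw [Submodule.map_comap_subtype, inf_eq_right.2 (hVK j)]
      exact hVfg j)
    (fun x => by
      obtain ⟨y, hy, hyx⟩ := x.2
      have hev : ∀ b ∈ y.support, ∀ᶠ j in atTop, b ∈ V j := fun b hb => by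
        have hb' : b ∈ Set.range g := by
          rw [← hg]
          exact (Finsupp.mem_supported _ _).1 hy hb
        obtain ⟨i, rfl⟩ := hb'
        filter_upwards [eventually_gt_atTop i] with j hj
        exact Finset.mem_image_of_mem g (Finset.mem_range.2 hj)
      obtain ⟨j, hj⟩ := ((eventually_all_finset _).2 hev).exists
      exact ⟨j, y, (Finsupp.mem_supported _ _).2 fun b hb => hj b hb, hyx⟩)
    sK (fun j z hz hDz => Subtype.ext <| by
      change D (c (s (V j) z)) = z
      rw [hDc, hs (V j) z hz (congrArg Subtype.val hDz), hKc z.2])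
  -- assembling the contractions of `p A^(S)` and of `c A^(T)`
  obtain ⟨q', hq1, hq2⟩ := exists_projection_supported (A := A) (S ∪ T)
  let κ : (B →₀ A) →ₗ[A] K := (c ∘ₗ q').codRestrict K fun x => hcK (hq1 x)
  have hκ {x} (hx : x ∈ Finsupp.supported A A (S ∪ T)) : (κ x : B →₀ A) = c x := by
    change c (q' x) = c x
    rw [hq2 x hx]
  have hD' := hmem hS.D_mem fun x hx => hDT hx
  have hp' := hmem hS.p_mem fun x hx => hpT hx
  have hκp {x} (hx : x ∈ Finsupp.supported A A (S ∪ T)) : κ (p x) = κ x :=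
    Subtype.ext (by rw [hκ hx, hκ (hp' x hx), hcp])
  have hκD {x} (hx : x ∈ Finsupp.supported A A (S ∪ T)) : κ (D x) = DK (κ x) := by
    refine Subtype.ext ?_
    change _ = D (κ x)
    rw [hκ hx, hκ (hD' x hx), hDc]
  have hpK (x : K) : p x = x := by rw [← hKc x.2, hpc]
  let H' : (B →₀ A) →ₗ[A] (B →₀ A) := E + K.subtype ∘ₗ h ∘ₗ κ
  have hH' (x) : H' x = E x + h (κ x) := rfl
  refine ⟨T, H', hbT, ⟨hD', hp', fun x hx => ?_, fun x hx => ?_, fun x hx => ?_, fun x hx => ?_⟩,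
    fun x hx => ?_⟩
  · exact add_mem (hSle (hES x)) (hKle (h (κ x)).2)
  · rw [hH', map_add, hpE, hpK]
  · rw [hH', hH', hEp, hκp hx]
  · have h1 : D (h (κ x)) + h (DK (κ x)) = c x := by
      rw [← hκ hx]
      exact congrArg Subtype.val (hh (κ x))
    rw [hH', hH', hκD hx, map_add, add_add_add_comm, h1, ← hedef, hcdef, add_sub_cancel]
  · have h1 : κ x = 0 := Subtype.ext (by rw [hκ (hSle hx), hcS hx]; rfl)
    rw [hH', h1, map_zero, hEH hx]
    exact add_zero _

/-- Neeman's theorem that pure acyclic complexes of projective modules are contractible, over a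
noetherian ring and in terms of local contractions: a Zorn argument on the contractions of
subcomplexes spanned by parts of the basis. -/
theorem exists_contraction_of_localContractions [IsNoetherianRing A]
    {D p : (B →₀ A) →ₗ[A] (B →₀ A)} (hDD : ∀ x, D (D x) = 0) (hpD : ∀ x, p (D x) = D x)
    (hDp : ∀ x, D (p x) = D x) (hpp : ∀ x, p (p x) = p x)
    (hloc : ∀ N : Submodule A (B →₀ A), N.FG → (∀ z ∈ N, D z = 0) →
      ∃ s : (B →₀ A) →ₗ[A] (B →₀ A), ∀ z ∈ N, D (s z) = p z) :
    ∃ H : (B →₀ A) →ₗ[A] (B →₀ A), ∀ x, D (H x) + H (D x) = p x := by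
  classical
  -- partial contractions, ordered by extension
  let X := { a : Set B × ((B →₀ A) →ₗ[A] (B →₀ A)) // IsContractionOn D p a.1 a.2 }
  let r (a b : X) : Prop :=
    a.1.1 ⊆ b.1.1 ∧ ∀ x ∈ Finsupp.supported A A a.1.1, b.1.2 x = a.1.2 x
  have rtrans {a b c : X} (hab : r a b) (hbc : r b c) : r a c :=
    ⟨hab.1.trans hbc.1, fun x hx => (hbc.2 x (Finsupp.supported_mono hab.1 hx)).trans (hab.2 x hx)⟩
  have rrefl (a : X) : r a a := ⟨subset_rfl, fun _ _ => rfl⟩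
  have hbot : IsContractionOn D p ∅ 0 := by
    have h0 {x : B →₀ A} (hx : x ∈ Finsupp.supported A A (∅ : Set B)) : x = 0 := by
      simpa [Finsupp.supported_empty] using hx
    constructor <;> intro x hx <;> simp [h0 hx]
  have hchain (C : Set X) (hC : IsChain r C) : ∃ ub, ∀ a ∈ C, r a ub := by
    rcases C.eq_empty_or_nonempty with rfl | hne
    · exact ⟨⟨(∅, 0), hbot⟩, by simp⟩
    have hdir (a b : X) (ha : a ∈ C) (hb : b ∈ C) : ∃ c ∈ C, r a c ∧ r b c := by
      rcases eq_or_ne a b with rfl | hab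
      · exact ⟨a, ha, rrefl a, rrefl a⟩
      · rcases hC ha hb hab with h | h
        · exact ⟨b, hb, h, rrefl b⟩
        · exact ⟨a, ha, rrefl a, h⟩
    let S : Set B := ⋃ a ∈ C, a.1.1
    let H : (B →₀ A) →ₗ[A] (B →₀ A) := Finsupp.linearCombination A fun b =>
      if h : ∃ a ∈ C, b ∈ a.1.1 then h.choose.1.2 (Finsupp.single b 1) else 0
    have hH (a : X) (ha : a ∈ C) : ∀ x ∈ Finsupp.supported A A a.1.1, H x = a.1.2 x := by
      intro x hx
      rw [← sub_eq_zero, ← LinearMap.sub_apply, ← Submodule.mem_bot A]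
      refine map_mem_of_single_mem (fun b hb => ?_) hx
      have h : ∃ a ∈ C, b ∈ a.1.1 := ⟨a, ha, hb⟩
      obtain ⟨d, -, hd1, hd2⟩ := hdir a h.choose ha h.choose_spec.1
      have e1 := hd1.2 _ (Finsupp.single_mem_supported A (1 : A) hb)
      have e2 := hd2.2 _ (Finsupp.single_mem_supported A (1 : A) h.choose_spec.2)
      rw [Submodule.mem_bot, LinearMap.sub_apply, sub_eq_zero, Finsupp.linearCombination_single,
        one_smul, dif_pos h, ← e1, e2]
    have hSx {x : B →₀ A} (hx : x ∈ Finsupp.supported A A S) :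
        ∃ a ∈ C, x ∈ Finsupp.supported A A a.1.1 := by
      have key (V : Finset B) (hV : (V : Set B) ⊆ S) : ∃ a ∈ C, (V : Set B) ⊆ a.1.1 := by
        induction V using Finset.induction_on with
        | empty => exact ⟨hne.some, hne.some_mem, by simp⟩
        | insert b V _ ih =>
          rw [Finset.coe_insert, Set.insert_subset_iff] at hV
          obtain ⟨a, ha, hVa⟩ := ih hV.2
          obtain ⟨d, hd, hbd⟩ := Set.mem_iUnion₂.1 hV.1
          obtain ⟨f, hf, h1, h2⟩ := hdir a d ha hd
          refine ⟨f, hf, ?_⟩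
          rw [Finset.coe_insert, Set.insert_subset_iff]
          exact ⟨h2.1 hbd, hVa.trans h1.1⟩
      exact key x.support ((Finsupp.mem_supported _ _).1 hx)
    have hle {a : X} (ha : a ∈ C) : Finsupp.supported A A a.1.1 ≤ Finsupp.supported A A S :=
      Finsupp.supported_mono (Set.subset_biUnion_of_mem (u := fun a : X => a.1.1) ha)
    refine ⟨⟨(S, H), ⟨fun x hx => ?_, fun x hx => ?_, fun x hx => ?_, fun x hx => ?_,
      fun x hx => ?_, fun x hx => ?_⟩⟩, fun a ha => ⟨Set.subset_biUnion_of_mem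
        (u := fun a : X => a.1.1) ha, hH a ha⟩⟩ <;> obtain ⟨a, ha, hxa⟩ := hSx hx
    · exact hle ha (a.2.D_mem x hxa)
    · exact hle ha (a.2.p_mem x hxa)
    · rw [hH a ha x hxa]
      exact hle ha (a.2.H_mem x hxa)
    · rw [hH a ha x hxa, a.2.p_H x hxa]
    · rw [hH a ha x hxa, hH a ha _ (a.2.p_mem x hxa), a.2.H_p x hxa]
    · rw [hH a ha x hxa, hH a ha _ (a.2.D_mem x hxa), a.2.contr x hxa]
  obtain ⟨m, hm⟩ := exists_maximal_of_chains_bounded hchain rtrans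
  refine ⟨m.1.2, fun x => m.2.contr x ((Finsupp.mem_supported _ _).2 fun b _ => ?_)⟩
  obtain ⟨T, H', hbT, hH', hext⟩ := m.2.exists_extension hDD hpD hDp hpp hloc b
  exact (hm ⟨(m.1.1 ∪ T, H'), hH'⟩ ⟨Set.subset_union_left, hext⟩).1 (Or.inr hbT)

end Extension

/-! ### Complexes as differential modules -/

section Total

open FrobDetect DirectSum

variable {A : Type u} [Ring A] (C : CochainComplex (ProjCat A) ℤ)

/-- The direct sum of the terms of a complex of projective modules. -/
abbrev Total : Type u := ⨁ n : ℤ, (C.X n).obj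

/-- The differential of a complex, as an endomorphism of the direct sum of its terms. -/
noncomputable def totalD : Total C →ₗ[A] Total C :=
  DirectSum.toModule A ℤ _ fun n =>
    DirectSum.lof A ℤ (fun n => (C.X n).obj) (n + 1) ∘ₗ (C.d n (n + 1)).hom.hom

theorem totalD_lof {i j : ℤ} (h : i + 1 = j) (x : (C.X i).obj) :
    totalD C (lof A ℤ (fun n => (C.X n).obj) i x) =
      lof A ℤ (fun n => (C.X n).obj) j ((C.d i j).hom.hom x) := by
  subst h
  simp [totalD]

theorem exists_totalContraction (h : Homotopy (𝟙 C) 0) :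
    ∃ H : Total C →ₗ[A] Total C, ∀ x, totalD C (H x) + H (totalD C x) = x := by
  let H : Total C →ₗ[A] Total C := DirectSum.toModule A ℤ _ fun n =>
    lof A ℤ (fun n => (C.X n).obj) (n - 1) ∘ₗ (h.hom n (n - 1)).hom.hom
  have hH {i j : ℤ} (hij : j + 1 = i) (x : (C.X i).obj) :
      H (lof A ℤ (fun n => (C.X n).obj) i x) =
        lof A ℤ (fun n => (C.X n).obj) j ((h.hom i j).hom.hom x) := by
    obtain rfl : j = i - 1 := by omega
    simp [H]
  refine ⟨H, fun x => ?_⟩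
  have key : totalD C ∘ₗ H + H ∘ₗ totalD C = LinearMap.id := by
    refine DirectSum.linearMap_ext _ fun n => LinearMap.ext fun x => ?_
    have hc := h.comm n
    rw [dNext_eq h.hom (show (ComplexShape.up ℤ).Rel n (n + 1) from rfl),
      prevD_eq h.hom (show (ComplexShape.up ℤ).Rel (n - 1) n from sub_add_cancel n 1)] at hc
    have hx : x = (h.hom (n + 1) n).hom.hom ((C.d n (n + 1)).hom.hom x) +
        (C.d (n - 1) n).hom.hom ((h.hom n (n - 1)).hom.hom x) := by
      rw [HomologicalComplex.zero_f, add_zero] at hc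
      exact congr(($hc).hom.hom x)
    change totalD C (H (lof A ℤ _ n x)) + H (totalD C (lof A ℤ _ n x)) = lof A ℤ _ n x
    rw [hH (sub_add_cancel n 1), totalD_lof C (sub_add_cancel n 1), totalD_lof C rfl, hH rfl,
      ← map_add, add_comm, ← hx]
  exact LinearMap.congr_fun key x

theorem nonempty_homotopy_of_totalContraction (H : Total C →ₗ[A] Total C)
    (hH : ∀ x, totalD C (H x) + H (totalD C x) = x) : Nonempty (Homotopy (𝟙 C) 0) := by
  let s (i j : ℤ) : C.X i ⟶ C.X j := ObjectProperty.homMk (ModuleCat.ofHom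
    (DirectSum.component A ℤ (fun n => (C.X n).obj) j ∘ₗ H ∘ₗ
      lof A ℤ (fun n => (C.X n).obj) i))
  have hs (i j : ℤ) (x) : (s i j).hom.hom x =
    DirectSum.component A ℤ (fun n => (C.X n).obj) j (H (lof A ℤ (fun n => (C.X n).obj) i x)) := rfl
  have hcomp {i j : ℤ} (hij : i + 1 = j) (y : Total C) :
      DirectSum.component A ℤ (fun n => (C.X n).obj) j (totalD C y) =
        (C.d i j).hom.hom (DirectSum.component A ℤ (fun n => (C.X n).obj) i y) := by
    have key : DirectSum.component A ℤ (fun n => (C.X n).obj) j ∘ₗ totalD C =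
        (C.d i j).hom.hom ∘ₗ DirectSum.component A ℤ (fun n => (C.X n).obj) i := by
      refine DirectSum.linearMap_ext _ fun n => LinearMap.ext fun x => ?_
      simp only [LinearMap.comp_apply]
      rw [totalD_lof C rfl]
      by_cases hn : n = i
      · subst hn hij
        rw [DirectSum.component.lof_self, DirectSum.component.lof_self]
      · rw [DirectSum.component.of, DirectSum.component.of, dif_neg (by omega), dif_neg hn,
          map_zero]
    exact LinearMap.congr_fun key y
  classical
  refine ⟨{ hom := fun i j => if j + 1 = i then s i j else 0
            zero := fun i j hij => if_neg hij
            comm := fun n => ?_ }⟩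
  rw [dNext_eq _ (show (ComplexShape.up ℤ).Rel n (n + 1) from rfl),
    prevD_eq _ (show (ComplexShape.up ℤ).Rel (n - 1) n from sub_add_cancel n 1), if_pos rfl,
    if_pos (sub_add_cancel n 1)]
  ext x
  have h := congr(DirectSum.component A ℤ (fun n => (C.X n).obj) n
    $(hH (lof A ℤ (fun n => (C.X n).obj) n x)))
  rw [map_add, hcomp (sub_add_cancel n 1), totalD_lof C rfl, DirectSum.component.lof_self] at h
  simp only [HomologicalComplex.id_f, HomologicalComplex.zero_f, add_zero]
  refine h.symm.trans ?_
  rw [add_comm]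
  rfl

theorem totalD_totalD (x : Total C) : totalD C (totalD C x) = 0 := by
  have key : totalD C ∘ₗ totalD C = 0 := by
    refine DirectSum.linearMap_ext _ fun n => LinearMap.ext fun x => ?_
    simp only [LinearMap.comp_apply]
    rw [totalD_lof C rfl, totalD_lof C rfl]
    have : (C.d (n + 1) (n + 1 + 1)).hom.hom ((C.d n (n + 1)).hom.hom x) = 0 :=
      congr(($(C.d_comp_d n (n + 1) (n + 1 + 1))).hom.hom x)
    rw [this, map_zero]
    rfl
  exact LinearMap.congr_fun key x

/-- The free module on all elements of all terms of `C` maps onto the direct sum of the terms. -/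
noncomputable def totalCover : ((Σ n, (C.X n).obj) →₀ A) →ₗ[A] Total C :=
  Finsupp.linearCombination A fun b => lof A ℤ (fun n => (C.X n).obj) b.1 b.2

theorem totalCover_single (b : Σ n, (C.X n).obj) (a : A) :
    totalCover C (Finsupp.single b a) = a • lof A ℤ (fun n => (C.X n).obj) b.1 b.2 := by
  simp [totalCover]

theorem exists_section_totalCover :
    ∃ i : Total C →ₗ[A] ((Σ n, (C.X n).obj) →₀ A), ∀ x, totalCover C (i x) = x := by
  have (n : ℤ) : Module.Projective A (C.X n).obj := (C.X n).property
  have hsurj : Function.Surjective (totalCover C) := by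
    rw [← LinearMap.range_eq_top, eq_top_iff]
    rintro x -
    induction x using DirectSum.induction_on with
    | zero => exact zero_mem _
    | of n x => exact ⟨Finsupp.single ⟨n, x⟩ 1, by rw [totalCover_single, one_smul]; rfl⟩
    | add x y hx hy => exact add_mem hx hy
  have : Module.Projective A (Total C) :=
    inferInstanceAs (Module.Projective A (Π₀ n : ℤ, (C.X n).obj))
  obtain ⟨i, hi⟩ := Module.projective_lifting_property (totalCover C) LinearMap.id hsurj
  exact ⟨i, fun x => LinearMap.congr_fun hi x⟩

end Total

/-! ### Base change of the total differential module -/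

section BaseChange

open FrobDetect DirectSum

variable {R A : Type u} [CommRing R] [Ring A] [Algebra R A] (k : Type u) [CommRing k] [Algebra R k]

attribute [local instance] moduleBase isScalarTower_moduleBase baseChangeModule

/-- The base change of an `A`-linear map from `M` to a free module, with the target written as a
free module over `A ⊗ k`. -/
theorem exists_baseChange_toFree {B : Type u} (M : ModuleCat.{u} A) (f : M →ₗ[A] (B →₀ A)) :
    ∃ g : (M ⊗[R] k) →ₗ[A ⊗[R] k] (B →₀ A ⊗[R] k), ∀ m : M, g (m ⊗ₜ 1) =
      (f m).mapRange (Algebra.TensorProduct.includeLeftRingHom : A →+* A ⊗[R] k) (map_zero _) := by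
  let j : (B →₀ A) →+ (B →₀ A ⊗[R] k) := Finsupp.mapRange.addMonoidHom
    (Algebra.TensorProduct.includeLeftRingHom : A →+* A ⊗[R] k).toAddMonoidHom
  have hj (a : A) (v : B →₀ A) : j (a • v) = (a ⊗ₜ[R] (1 : k)) • j v := by
    ext b
    simp [j]
  have hr (r : R) (v : B →₀ A) : j (algebraMap R A r • v) = r • j v := by
    rw [hj, ← Algebra.TensorProduct.algebraMap_apply, algebraMap_smul]
  let t : (M ⊗[R] k) →ₗ[R] (B →₀ A ⊗[R] k) :=
    TensorProduct.lift (LinearMap.mk₂ R (fun m c => ((1 : A) ⊗ₜ[R] c) • j (f m))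
      (fun m n c => by rw [map_add, map_add, smul_add])
      (fun r m c => by
        have e : f (r • m) = algebraMap R A r • f m := map_smul f (algebraMap R A r) m
        rw [e, hr, smul_comm])
      (fun m b c => by rw [TensorProduct.tmul_add, add_smul])
      (fun r m c => by rw [TensorProduct.tmul_smul, smul_assoc]))
  have ht (m : M) (c : k) : t (m ⊗ₜ[R] c) = ((1 : A) ⊗ₜ[R] c) • j (f m) := rfl
  refine ⟨{ toFun := t, map_add' := map_add t, map_smul' := fun x y => ?_ }, fun m => ?_⟩
  · induction x with
    | zero => simp only [zero_smul, map_zero]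
    | add x₁ x₂ h₁ h₂ => simp only [add_smul, map_add, h₁, h₂]
    | tmul a b =>
      induction y with
      | zero => simp only [smul_zero, map_zero]
      | add y₁ y₂ h₁ h₂ => simp only [smul_add, map_add, h₁, h₂]
      | tmul m c =>
        rw [baseChange_smul_tmul, ht, ht, map_smul, hj, smul_smul, RingHom.id_apply, smul_smul]
        simp
  · change t (m ⊗ₜ 1) = j (f m)
    rw [ht, ← Algebra.TensorProduct.one_def, one_smul]

variable (C : CochainComplex (ProjCat A) ℤ)

variable (R) in
/-- The base change `C ⊗ k` of a complex of projective `A`-modules. -/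
noncomputable abbrev baseChangeComplex : CochainComplex (ProjCat (A ⊗[R] k)) ℤ :=
  ((projBaseChange R A k).mapHomologicalComplex (ComplexShape.up ℤ)).obj C

variable (R) in
/-- The map `x ↦ x ⊗ 1` from a term of `C` to the corresponding term of `C ⊗ k`. -/
noncomputable def baseChangeIncl (n : ℤ) :
    (C.X n).obj →+ ((baseChangeComplex R k C).X n).obj :=
  ((TensorProduct.mk R (C.X n).obj k).flip 1).toAddMonoidHom

theorem baseChangeIncl_smul (n : ℤ) (a : A) (x : (C.X n).obj) :
    baseChangeIncl R k C n (a • x) = (a ⊗ₜ[R] (1 : k)) • baseChangeIncl R k C n x := by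
  refine Eq.trans ?_ (baseChange_smul_tmul k (C.X n).obj a 1 x 1).symm
  rw [mul_one]
  rfl

theorem d_baseChangeIncl (i j : ℤ) (x : (C.X i).obj) :
    ((baseChangeComplex R k C).d i j).hom.hom (baseChangeIncl R k C i x) =
      baseChangeIncl R k C j ((C.d i j).hom.hom x) := rfl

variable (R) in
/-- The map `x ↦ x ⊗ 1` on the direct sum of the terms of `C`. -/
noncomputable def totalBaseChange : Total C →+ Total (baseChangeComplex R k C) :=
  DirectSum.toAddMonoid fun n =>
    (lof (A ⊗[R] k) ℤ (fun n => ((baseChangeComplex R k C).X n).obj) n).toAddMonoidHom.comp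
      (baseChangeIncl R k C n)

theorem totalBaseChange_lof (n : ℤ) (x : (C.X n).obj) :
    totalBaseChange R k C (lof A ℤ (fun n => (C.X n).obj) n x) =
      lof (A ⊗[R] k) ℤ (fun n => ((baseChangeComplex R k C).X n).obj) n
        (baseChangeIncl R k C n x) :=
  DirectSum.toAddMonoid_of _ _ _

theorem totalBaseChange_smul (a : A) (x : Total C) :
    totalBaseChange R k C (a • x) = (a ⊗ₜ[R] (1 : k)) • totalBaseChange R k C x := by
  induction x using DirectSum.induction_on with
  | zero => simp
  | of n x =>
    change totalBaseChange R k C (a • lof A ℤ (fun n => (C.X n).obj) n x) =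
      _ • totalBaseChange R k C (lof A ℤ (fun n => (C.X n).obj) n x)
    rw [← map_smul, totalBaseChange_lof, totalBaseChange_lof, ← map_smul, baseChangeIncl_smul]
  | add x y hx hy => simp only [smul_add, map_add, hx, hy]

theorem totalD_totalBaseChange (x : Total C) :
    totalD (baseChangeComplex R k C) (totalBaseChange R k C x) =
      totalBaseChange R k C (totalD C x) := by
  induction x using DirectSum.induction_on with
  | zero => simp
  | of n x =>
    change totalD _ (totalBaseChange R k C (lof A ℤ (fun n => (C.X n).obj) n x)) =
      totalBaseChange R k C (totalD C (lof A ℤ (fun n => (C.X n).obj) n x))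
    rw [totalBaseChange_lof, totalD_lof _ rfl, totalD_lof _ rfl, totalBaseChange_lof,
      d_baseChangeIncl]
  | add x y hx hy => simp only [map_add, hx, hy]

variable {k C} in
theorem total_hom_ext {N : Type u} [AddCommGroup N] [Module (A ⊗[R] k) N]
    {f g : Total (baseChangeComplex R k C) →ₗ[A ⊗[R] k] N}
    (h : ∀ x, f (totalBaseChange R k C x) = g (totalBaseChange R k C x)) : f = g := by
  refine DirectSum.linearMap_ext _ fun n => ?_
  refine baseChange_hom_ext k (M := (C.X n).obj) fun m => ?_
  have := h (lof A ℤ (fun n => (C.X n).obj) n m)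
  rw [totalBaseChange_lof] at this
  exact this

/-- A section `i` of the cover of the total module of `C` by a free module gives a section of a
cover of the total module of `C ⊗ k` by the free `A ⊗ k`-module on the same basis, compatibly with
the extension of scalars of matrices. -/
theorem exists_baseChange_section
    (i : Total C →ₗ[A] ((Σ n, (C.X n).obj) →₀ A)) (hi : ∀ x, totalCover C (i x) = x) :
    ∃ (r' : ((Σ n, (C.X n).obj) →₀ A ⊗[R] k) →ₗ[A ⊗[R] k] Total (baseChangeComplex R k C))
      (i' : Total (baseChangeComplex R k C) →ₗ[A ⊗[R] k] ((Σ n, (C.X n).obj) →₀ A ⊗[R] k)),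
      (∀ x, r' (i' x) = x) ∧
      (∀ b, r' (Finsupp.single b 1) =
        totalBaseChange R k C (totalCover C (Finsupp.single b 1))) ∧
      ∀ x, i' (totalBaseChange R k C x) =
        (i x).mapRange (Algebra.TensorProduct.includeLeftRingHom : A →+* A ⊗[R] k)
          (map_zero _) := by
  have hex (n : ℤ) := exists_baseChange_toFree (R := R) k (C.X n).obj
    (i ∘ₗ lof A ℤ (fun n => (C.X n).obj) n)
  choose g hg using hex
  let r' : ((Σ n, (C.X n).obj) →₀ A ⊗[R] k) →ₗ[A ⊗[R] k] Total (baseChangeComplex R k C) :=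
    Finsupp.linearCombination _ fun b =>
      totalBaseChange R k C (lof A ℤ (fun n => (C.X n).obj) b.1 b.2)
  let i' : Total (baseChangeComplex R k C) →ₗ[A ⊗[R] k] ((Σ n, (C.X n).obj) →₀ A ⊗[R] k) :=
    DirectSum.toModule _ ℤ _ g
  have hr' (x : (Σ n, (C.X n).obj) →₀ A) :
      r' (x.mapRange (Algebra.TensorProduct.includeLeftRingHom : A →+* A ⊗[R] k) (map_zero _)) =
        totalBaseChange R k C (totalCover C x) := by
    induction x using Finsupp.induction_linear with
    | zero => simp
    | add x y hx hy => rw [Finsupp.mapRange_add (map_add _), map_add, hx, hy, map_add, map_add]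
    | single b a =>
      rw [Finsupp.mapRange_single, Finsupp.linearCombination_single, totalCover_single,
        totalBaseChange_smul]
      rfl
  have hi' (x : Total C) : i' (totalBaseChange R k C x) =
      (i x).mapRange (Algebra.TensorProduct.includeLeftRingHom : A →+* A ⊗[R] k)
        (map_zero _) := by
    induction x using DirectSum.induction_on with
    | zero => simp
    | add x y hx hy => rw [map_add, map_add, map_add, Finsupp.mapRange_add (map_add _), hx, hy]
    | of n x =>
      change i' (totalBaseChange R k C (lof A ℤ (fun n => (C.X n).obj) n x)) = _
      rw [totalBaseChange_lof]
      exact (DirectSum.toModule_lof _ _ _).trans (hg n x)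
  refine ⟨r', i', fun x => ?_, fun b => ?_, hi'⟩
  · have key : r' ∘ₗ i' = LinearMap.id := total_hom_ext fun x => by
      rw [LinearMap.comp_apply, hi', hr', hi, LinearMap.id_apply]
    exact LinearMap.congr_fun key x
  · rw [totalCover_single, one_smul, Finsupp.linearCombination_single, one_smul]

end BaseChange

/-! ### Contractibility from the fibres -/

section Fibres

open FrobDetect DirectSum

variable {R A : Type u} [CommRing R] [IsNoetherianRing R] [Ring A] [Algebra R A] [Module.Finite R A]

/-- Over a finite algebra over a noetherian ring, a complex of projective modules is contractible
if all its fibres are contractible. -/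
theorem nonempty_homotopy_of_fibres (C : CochainComplex (ProjCat A) ℤ)
    (hC : ∀ (P : Ideal R) [P.IsPrime],
      Nonempty (Homotopy (𝟙 (baseChangeComplex R P.ResidueField C)) 0)) :
    Nonempty (Homotopy (𝟙 C) 0) := by
  obtain ⟨i, hi⟩ := exists_section_totalCover C
  let D : ((Σ n, (C.X n).obj) →₀ A) →ₗ[A] ((Σ n, (C.X n).obj) →₀ A) :=
    i ∘ₗ totalD C ∘ₗ totalCover C
  let p : ((Σ n, (C.X n).obj) →₀ A) →ₗ[A] ((Σ n, (C.X n).obj) →₀ A) := i ∘ₗ totalCover C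
  have hDdef (x) : D x = i (totalD C (totalCover C x)) := rfl
  have hpdef (x) : p x = i (totalCover C x) := rfl
  have hd : IsDifferentialOn D p := by
    constructor <;> refine LinearMap.ext fun x => ?_ <;>
      simp only [LinearMap.comp_apply, hDdef, hpdef, hi, totalD_totalD, map_zero,
        LinearMap.zero_apply]
  have hprime (P : Ideal R) [P.IsPrime] (L : Type u) [AddCommGroup L] [Module R L]
      [Module Aᵐᵒᵖ L] [IsScalarTower R Aᵐᵒᵖ L] (hL : ∀ a ∈ P, ∀ l : L, a • l = 0)
      (z : (Σ n, (C.X n).obj) →₀ L) (hz : coeffMap L D z = 0) :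
      ∃ r ∉ P, ∃ w, r • coeffMap L p z = coeffMap L D w := by
    obtain ⟨h⟩ := hC P
    obtain ⟨H, hH⟩ := exists_totalContraction _ h
    obtain ⟨r', i', hri, hr, hi'⟩ := exists_baseChange_section (R := R) P.ResidueField C i hi
    refine exists_smul_eq_boundary_of_contraction P
      (D' := i' ∘ₗ totalD (baseChangeComplex R P.ResidueField C) ∘ₗ r') (p' := i' ∘ₗ r')
      (H' := i' ∘ₗ H ∘ₗ r') (fun b => ?_) (fun b => ?_) ?_ L hL z hz
    · rw [LinearMap.comp_apply, LinearMap.comp_apply, hr, totalD_totalBaseChange, hi', hDdef]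
    · rw [LinearMap.comp_apply, hr, hi', hpdef]
    · refine LinearMap.ext fun x => ?_
      simp only [LinearMap.comp_apply, LinearMap.add_apply, hri, ← map_add, hH]
  have : IsScalarTower R Aᵐᵒᵖ A := ⟨fun r a x => by simp⟩
  have hnoeth : IsNoetherianRing A := IsNoetherianRing.of_finite R A
  obtain ⟨H, hH⟩ := exists_contraction_of_localContractions (D := D) (p := p)
    (LinearMap.congr_fun hd.D_D) (LinearMap.congr_fun hd.p_D) (LinearMap.congr_fun hd.D_p)
    (LinearMap.congr_fun hd.p_p) <| exists_localContraction fun m U hU => by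
      have : Module.Finite Aᵐᵒᵖ U := Module.Finite.iff_fg.2 hU
      exact coeffAcyclic_of_primes R hd hprime U
  refine nonempty_homotopy_of_totalContraction C (totalCover C ∘ₗ H ∘ₗ i) fun x => ?_
  have h := congrArg (totalCover C) (hH (i x))
  rw [hpdef, hi, hi, map_add, hDdef, hDdef, hi, hi] at h
  exact h

end Fibres

end FibreDetection


theorem proposition3p6 (R A : Type u) [CommRing R] [IsNoetherianRing R] [Ring A] [Algebra R A]
    (hA : FrobDetect.IsFrobeniusAlgebra R A) (X : FrobDetect.KProjOver R A) :
    IsZero X ↔ ∀ p : PrimeSpectrum R, IsZero ((FrobDetect.fibre R A p).obj X) := by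
  have hfin := hA.finite
  constructor
  · intro hX p
    rw [IsZero.iff_id_eq_zero] at hX
    have h0 : IsZero X.obj := by
      rw [IsZero.iff_id_eq_zero]
      exact congrArg (fun f => f.hom) hX
    exact ((FrobDetect.projBaseChange R A p.asIdeal.ResidueField).mapHomotopyCategory
      (ComplexShape.up ℤ)).map_isZero h0
  · intro hX
    have h0 : IsZero X.obj := (HomotopyCategory.isZero_quotient_obj_iff X.obj.as).2 <|
      FibreDetection.nonempty_homotopy_of_fibres (R := R) X.obj.as fun P hP =>
        (HomotopyCategory.isZero_quotient_obj_iff _).1 (hX ⟨P, hP⟩)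
    rw [IsZero.iff_id_eq_zero] at h0 ⊢
    exact ObjectProperty.hom_ext _ h0
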